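/- Let $\nu$ be a random variable with values in $\{1,2,\dots\}$ such that $\mathbf E(t^\nu)<\infty$ for some $t>1$ and $m:=\mathbf E(\nu)>1$. Let $Y_0$ be a random variable with values in $(0,\infty)$, let $\alpha>-2$, and assume that there are constants $0<c_3\le c_4<\infty$ such that, for all sufficiently large $x$, $$c_3\,x^{\alpha}m^{-x}\le \mathbb P(Y_0\ge x)\le c_4\,x^{\alpha}m^{-x}.$$ For $p\in[0,1]$ let $X_0$ have law $(1-p)\,\delta_0+p\,P_{Y_0}$, where $P_{Y_0}$ is the law of $Y_0$, and define the laws of $X_1,X_2,\dots$ recursively by $$X_{n+1}\overset{\mathrm{law}}{=}(X_{n,1}+\cdots+X_{n,\nu}-1)^+,\qquad n\ge 0,$$ where $X_{n,1},X_{n,2},\dots$ are independent copies of $X_n$, independent of $\nu$. Then for every $p\in[0,1]$ all $X_n$ are integrable, the sequence $\mathbb E(X_n)/m^n$ is non-increasing in $n$, and hence the free energy $F_\infty(p):=\lim_{n\to\infty}\mathbb E(X_n)/m^n$ exists in $[0,\infty)$. The critical parameter $p_c\in[0,1]$ (characterized by $F_\infty(p)>0$ for $p\in(p_c,1]$ and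 $F_\infty(p)=0$ for $p\in[0,p_c)$) equals $0$, that is, $F_\infty(p)>0$ for all $p\in(0,1]$. Moreover, with $\chi:=\frac1{\alpha+2}$, $$F_\infty(p)=\exp\Big(-\frac1{p^{\chi+o(1)}}\Big)\qquad\text{as } p\downarrow 0,$$ and there is a constant $c_5>0$ such that, for all sufficiently small $p>0$, $$F_\infty(p)\le\exp\Big(-\frac{c_5}{p^{\chi}}\Big).$$ -/

import Mathlib

open MeasureTheory Filter Topology Set

namespace DerridaRetaux

/-- One step of the recursion on laws. If `P` is the law of `X_n` and `N` is the law of `ν`, this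
is the law of `(X_{n,1} + ⋯ + X_{n,ν} - 1)^+`, where `X_{n,1}, X_{n,2}, …` are i.i.d. with law `P`
and are independent of `ν`: draw `k` from `N`, then draw `k` independent values from `P`. -/
noncomputable def step (N : Measure ℕ) (P : Measure ℝ) : Measure ℝ :=
  N.bind fun k =>
    (Measure.pi fun _ : Fin k => P).map fun x : Fin k → ℝ => max (∑ i, x i - 1) 0

/-- The law `(1 - p) δ_0 + p ρ` of `X_0`, where `ρ` is the law of `Y_0`. -/
noncomputable def initialLaw (ρ : Measure ℝ) (p : ℝ) : Measure ℝ :=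
  ENNReal.ofReal (1 - p) • Measure.dirac 0 + ENNReal.ofReal p • ρ

/-- The law of `X_n`. -/
noncomputable def law (N : Measure ℕ) (ρ : Measure ℝ) (p : ℝ) : ℕ → Measure ℝ
  | 0 => initialLaw ρ p
  | n + 1 => step N (law N ρ p n)

/-- The mean `m = E(ν)`. -/
noncomputable def mean (N : Measure ℕ) : ℝ := ∫ k, (k : ℝ) ∂N

/-- The normalized expectation `E(X_n) / m^n`. -/
noncomputable def normalizedMean (N : Measure ℕ) (ρ : Measure ℝ) (p : ℝ) (n : ℕ) : ℝ :=
  (∫ x, x ∂(law N ρ p n)) / mean N ^ n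

/-- The free energy `F_∞(p) = lim_{n → ∞} E(X_n) / m^n`. -/
noncomputable def freeEnergy (N : Measure ℕ) (ρ : Measure ℝ) (p : ℝ) : ℝ :=
  limUnder atTop (normalizedMean N ρ p)

/-- `q ∈ [0,1]` is the critical parameter: for `p ∈ [0,1]`, `F_∞(p) > 0` if `p > q` and
`F_∞(p) = 0` if `p < q`. -/
def IsCriticalParameter (N : Measure ℕ) (ρ : Measure ℝ) (q : ℝ) : Prop :=
  q ∈ Icc (0 : ℝ) 1 ∧
    ∀ p ∈ Icc (0 : ℝ) 1,
      (q < p → 0 < freeEnergy N ρ p) ∧ (p < q → freeEnergy N ρ p = 0)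

end DerridaRetaux

/-!
The two bounds on the free energy compare the laws of the system with simpler objects, and use the
recursion only through integrals of test functions against the laws of sums
(`lintegral_sumLaw_succ`, `lintegral_step`). Write `P_n` for the law of `X_n` and `m` for the mean
of `ν`. From `m E(X_n) - 1 ≤ E(X_{n+1}) ≤ m E(X_n)` it follows that `E(X_n) / m^n` decreases, that
`F_∞ ≤ E(X_n) / m^n`, and that `F_∞ ≥ m^{-n}` as soon as `E(X_n) ≥ 1 + 1 / (m - 1)`
(`le_freeEnergy`). It remains to find how long `E(X_n)` stays bounded. Heuristically, the tails
renormalized by `m^k` are transported to the left at unit speed and grow by mergers of pairs: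
`∂_t b = ∂_x b + c b * b`, with `b(0, x) = p x^α`. The quadratic term takes over at the scale `L`
for which `p L^(α+2)` is of order `1`, that is, `L = p^(-χ)`.

*Upper bound* (`exists_freeEnergy_le`). If `p n^(α+2)` is small, then `E(X_n)` is bounded. First,
`Y_0` is truncated at `2n`; a stochastic domination with an additive error (`Dominated`), which one
step multiplies by `m`, shows that this changes `E(X_n)` by a bounded amount. For the truncated
system, consider `Φ_j = E(m^{X_j} (X_j + j + 1)^β; X_j > 0)` with `max(0, -1 - α) < β < 1`. The
weight is designed so that the shift by `-1` costs exactly a factor `m`. Since `x ↦ x^β` is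
subadditive, `Φ_{j+1} ≤ Φ_j (1 + D (j+1)^(-β) Φ_j)` (`lintegral_lyapunovWeight_step_le`).
As `Φ_0 ≤ C p n^(α+β+1)` and `∑_{j<n} (j+1)^(-β) ≤ C n^(1-β)`, the functional at most doubles in
the first `n` steps when `p n^(α+2)` is small.

*Lower bound* (`exists_le_freeEnergy`). If `p l^(α+2) ≥ l^ε` and `l` is large, then
`F_∞ ≥ m^{-Bl}` with `B` depending on `ε` only. A law that gives mass at least `C m^{-k}` to
`[k, ∞)` is already supercritical: the maximum over the particles that merge in the next `k - R`
steps has a large mean (`exists_le_freeEnergy_of_tail`). Otherwise all these tails are small, so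
that a measure `r_n` which keeps only single survivors and mergers of exactly two particles is a
minorant of `P_n` with negligible loss (`IsMinorant.succ`). For `a_n(k) = m^k r_n{k}` this gives
`a_{n+1}(k) ≥ (1 - δ) a_n(k+1) + c ∑_i a_n(i) a_n(k+1-i)`, and an amplitude `A` on `[4l, 12l]`
becomes one of order `l² A²` after `6l` steps (`growth_stage`). So `l² A` is squared in each stage;
it starts at a positive power of `l`, and a bounded number of stages makes it exceed `l³`, which
contradicts the smallness of the tails.
-/

namespace DerridaRetaux

open scoped ENNReal

/-! ### Laws of sums and the recursion -/

/-- The law of the sum of `k` independent random variables of law `P`. -/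
noncomputable def sumLaw (P : Measure ℝ) (k : ℕ) : Measure ℝ :=
  (Measure.pi fun _ : Fin k => P).map fun x => ∑ i, x i

instance (P : Measure ℝ) [IsProbabilityMeasure P] (k : ℕ) : IsProbabilityMeasure (sumLaw P k) :=
  Measure.isProbabilityMeasure_map (by fun_prop)

lemma lintegral_sumLaw_zero (P : Measure ℝ) [IsProbabilityMeasure P] {ψ : ℝ → ℝ≥0∞}
    (hψ : Measurable ψ) : ∫⁻ s, ψ s ∂sumLaw P 0 = ψ 0 := by
  rw [sumLaw, lintegral_map hψ (by fun_prop)]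
  simp

lemma lintegral_sumLaw_succ (P : Measure ℝ) [IsProbabilityMeasure P] (k : ℕ) {ψ : ℝ → ℝ≥0∞}
    (hψ : Measurable ψ) :
    ∫⁻ s, ψ s ∂sumLaw P (k + 1) = ∫⁻ y, ∫⁻ s, ψ (y + s) ∂sumLaw P k ∂P := by
  rw [sumLaw, lintegral_map hψ (by fun_prop)]
  have h := measurePreserving_piFinSuccAbove (fun _ : Fin (k + 1) => P) 0
  have hf : Measurable fun z : ℝ × (Fin k → ℝ) => ψ (z.1 + ∑ i, z.2 i) := by fun_prop
  calc ∫⁻ x : Fin (k + 1) → ℝ, ψ (∑ i, x i) ∂(Measure.pi fun _ => P)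
      = ∫⁻ x : Fin (k + 1) → ℝ, (fun z : ℝ × (Fin k → ℝ) => ψ (z.1 + ∑ i, z.2 i))
          (MeasurableEquiv.piFinSuccAbove (fun _ => ℝ) 0 x) ∂(Measure.pi fun _ => P) := by
        refine lintegral_congr fun x => ?_
        simp [Fin.sum_univ_succ, MeasurableEquiv.piFinSuccAbove, Fin.insertNthEquiv, Fin.tail]
    _ = ∫⁻ z, ψ (z.1 + ∑ i, z.2 i) ∂(P.prod (Measure.pi fun _ : Fin k => P)) :=
        h.lintegral_comp hf
    _ = ∫⁻ y, ∫⁻ s, ψ (y + s) ∂sumLaw P k ∂P := by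
        rw [lintegral_prod _ hf.aemeasurable]
        refine lintegral_congr fun y => ?_
        rw [sumLaw, lintegral_map (by fun_prop) (by fun_prop)]

lemma lintegral_sumLaw_succ' (P : Measure ℝ) [IsProbabilityMeasure P] (k : ℕ) {ψ : ℝ → ℝ≥0∞}
    (hψ : Measurable ψ) :
    ∫⁻ s, ψ s ∂sumLaw P (k + 1) = ∫⁻ s, ∫⁻ y, ψ (y + s) ∂P ∂sumLaw P k := by
  rw [lintegral_sumLaw_succ P k hψ, lintegral_lintegral_swap]
  exact Measurable.aemeasurable (by fun_prop)

lemma lintegral_step (N : Measure ℕ) (P : Measure ℝ) {φ : ℝ → ℝ≥0∞} (hφ : Measurable φ) :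
    ∫⁻ x, φ x ∂step N P = ∫⁻ k, ∫⁻ s, φ (max (s - 1) 0) ∂sumLaw P k ∂N := by
  rw [step, Measure.lintegral_bind Measurable.of_discrete.aemeasurable hφ.aemeasurable]
  refine lintegral_congr fun k => ?_
  rw [sumLaw, lintegral_map hφ (by fun_prop), lintegral_map (by fun_prop) (by fun_prop)]

instance (N : Measure ℕ) [IsProbabilityMeasure N] (P : Measure ℝ) [IsProbabilityMeasure P] :
    IsProbabilityMeasure (step N P) := by
  refine ⟨?_⟩
  have h := lintegral_step N P (φ := fun _ => 1) measurable_const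
  simpa using h

lemma step_Iio_zero (N : Measure ℕ) (P : Measure ℝ) : step N P (Iio 0) = 0 := by
  have h := lintegral_step N P (φ := indicator (Iio 0) 1)
    (measurable_one.indicator measurableSet_Iio)
  rw [lintegral_indicator_one measurableSet_Iio] at h
  rw [h]
  simp [indicator]

lemma sumLaw_Iio_zero {P : Measure ℝ} [IsProbabilityMeasure P] (hP : P (Iio 0) = 0) (k : ℕ) :
    sumLaw P k (Iio 0) = 0 := by
  induction k with
  | zero =>
    have h := lintegral_sumLaw_zero P (ψ := indicator (Iio 0) 1)
      (measurable_one.indicator measurableSet_Iio)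
    rw [lintegral_indicator_one measurableSet_Iio] at h
    simpa using h
  | succ k ih =>
    have h := lintegral_sumLaw_succ P k (ψ := indicator (Iio 0) 1)
      (measurable_one.indicator measurableSet_Iio)
    rw [lintegral_indicator_one measurableSet_Iio] at h
    rw [h, lintegral_eq_zero_iff (by
      refine Measurable.lintegral_prod_right' (f := fun z : ℝ × ℝ => indicator (Iio 0) 1 (z.1 + z.2))
        ?_
      exact (measurable_one.indicator measurableSet_Iio).comp (by fun_prop))]
    have h1 : ∀ᵐ y ∂P, 0 ≤ y := by
      rw [ae_iff]; simpa [Iio] using hP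
    have h2 : ∀ᵐ y ∂sumLaw P k, 0 ≤ y := by
      rw [ae_iff]; simpa [Iio] using ih
    filter_upwards [h1] with y hy
    simp only [Pi.zero_apply]
    rw [lintegral_eq_zero_iff (by
      exact (measurable_one.indicator measurableSet_Iio).comp (by fun_prop))]
    filter_upwards [h2] with s hs
    simp [indicator, not_lt.2 (add_nonneg hy hs)]

/-- The parameter is taken from the subtype `Icc 0 1`, so that the instance can be inferred. -/
instance isProbabilityMeasure_initialLaw (ρ : Measure ℝ) [IsProbabilityMeasure ρ] (p : Icc (0 : ℝ) 1) :
    IsProbabilityMeasure (initialLaw ρ p) := by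
  refine ⟨?_⟩
  simp only [initialLaw, Measure.coe_add, Measure.coe_smul, Pi.add_apply, Pi.smul_apply,
    measure_univ, smul_eq_mul, mul_one]
  rw [← ENNReal.ofReal_add (by linarith [p.2.2]) p.2.1]
  simp

instance isProbabilityMeasure_law (N : Measure ℕ) [IsProbabilityMeasure N] (ρ : Measure ℝ)
    [IsProbabilityMeasure ρ] (p : Icc (0 : ℝ) 1) (n : ℕ) :
    IsProbabilityMeasure (law N ρ p n) := by
  induction n with
  | zero => exact isProbabilityMeasure_initialLaw ρ p
  | succ n ih => rw [law]; infer_instance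

lemma lintegral_initialLaw (ρ : Measure ℝ) (p : ℝ) {φ : ℝ → ℝ≥0∞} :
    ∫⁻ x, φ x ∂initialLaw ρ p =
      ENNReal.ofReal (1 - p) * φ 0 + ENNReal.ofReal p * ∫⁻ x, φ x ∂ρ := by
  simp [initialLaw]

lemma law_Iio_zero (N : Measure ℕ) {ρ : Measure ℝ} (hρ : ρ (Iio 0) = 0) (p : ℝ) (n : ℕ) :
    law N ρ p n (Iio 0) = 0 := by
  cases n with
  | zero => simp [law, initialLaw, hρ]
  | succ n => exact step_Iio_zero _ _

lemma ae_nonneg {P : Measure ℝ} (hP : P (Iio 0) = 0) : ∀ᵐ x ∂P, 0 ≤ x := by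
  rw [ae_iff]; simpa [Iio] using hP

lemma lintegral_ofReal_sumLaw {P : Measure ℝ} [IsProbabilityMeasure P] (hP : P (Iio 0) = 0)
    (k : ℕ) : ∫⁻ s, ENNReal.ofReal s ∂sumLaw P k = k * ∫⁻ x, ENNReal.ofReal x ∂P := by
  induction k with
  | zero => rw [lintegral_sumLaw_zero P ENNReal.measurable_ofReal]; simp
  | succ k ih =>
    rw [lintegral_sumLaw_succ P k ENNReal.measurable_ofReal]
    have : ∀ᵐ y ∂P, ∫⁻ s, ENNReal.ofReal (y + s) ∂sumLaw P k
        = ENNReal.ofReal y + k * ∫⁻ x, ENNReal.ofReal x ∂P := by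
      filter_upwards [ae_nonneg hP] with y hy
      have : ∫⁻ s, ENNReal.ofReal (y + s) ∂sumLaw P k
          = ∫⁻ s, ENNReal.ofReal y + ENNReal.ofReal s ∂sumLaw P k := by
        refine lintegral_congr_ae ?_
        filter_upwards [ae_nonneg (sumLaw_Iio_zero hP k)] with s hs
        rw [ENNReal.ofReal_add hy hs]
      rw [this, lintegral_add_left measurable_const, ih]
      simp
    rw [lintegral_congr_ae this, lintegral_add_left ENNReal.measurable_ofReal]
    simp
    ring

/-- A positive mean rules out the junk value `0` of a divergent integral. -/
lemma integrable_natCast {N : Measure ℕ} (hm : 1 < mean N) :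
    Integrable (fun k : ℕ => (k : ℝ)) N := by
  by_contra h
  rw [mean, integral_undef h] at hm
  linarith

/-- The mean of `ν`, as an extended nonnegative real. -/
lemma lintegral_natCast {N : Measure ℕ} (hm : 1 < mean N) :
    ∫⁻ k, (k : ℝ≥0∞) ∂N = ENNReal.ofReal (mean N) := by
  rw [mean, ofReal_integral_eq_lintegral_ofReal (integrable_natCast hm)
    (ae_of_all _ fun k => Nat.cast_nonneg k)]
  simp

lemma lintegral_ofReal_step_le {N : Measure ℕ} (hm : 1 < mean N)
    {P : Measure ℝ} [IsProbabilityMeasure P] (hP : P (Iio 0) = 0) :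
    ∫⁻ x, ENNReal.ofReal x ∂step N P ≤ ENNReal.ofReal (mean N) * ∫⁻ x, ENNReal.ofReal x ∂P := by
  rw [lintegral_step N P ENNReal.measurable_ofReal, ← lintegral_natCast hm,
    ← lintegral_mul_const _ Measurable.of_discrete]
  refine lintegral_mono fun k => ?_
  rw [← lintegral_ofReal_sumLaw hP]
  refine lintegral_mono_ae ?_
  filter_upwards [ae_nonneg (sumLaw_Iio_zero hP k)] with s hs
  exact ENNReal.ofReal_le_ofReal (max_le (by linarith) hs)

lemma le_lintegral_ofReal_step {N : Measure ℕ} [IsProbabilityMeasure N] (hm : 1 < mean N)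
    {P : Measure ℝ} [IsProbabilityMeasure P] (hP : P (Iio 0) = 0) :
    ENNReal.ofReal (mean N) * ∫⁻ x, ENNReal.ofReal x ∂P ≤
      ∫⁻ x, ENNReal.ofReal x ∂step N P + 1 := by
  rw [lintegral_step N P ENNReal.measurable_ofReal, ← lintegral_natCast hm,
    ← lintegral_mul_const _ Measurable.of_discrete]
  have h1 : (1 : ℝ≥0∞) = ∫⁻ _, 1 ∂N := by simp
  rw [h1, ← lintegral_add_right _ measurable_const]
  refine lintegral_mono fun k => ?_
  have h2 : (1 : ℝ≥0∞) = ∫⁻ _, 1 ∂sumLaw P k := by simp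
  rw [← lintegral_ofReal_sumLaw hP]
  simp only
  conv_rhs => rw [h2]
  rw [← lintegral_add_right _ measurable_const]
  refine lintegral_mono fun s => ?_
  calc ENNReal.ofReal s ≤ ENNReal.ofReal (max (s - 1) 0 + 1) :=
        ENNReal.ofReal_le_ofReal (by linarith [le_max_left (s - 1) 0])
    _ ≤ ENNReal.ofReal (max (s - 1) 0) + ENNReal.ofReal 1 := ENNReal.ofReal_add_le
    _ = _ := by simp

/-! ### The free energy as a decreasing limit -/

lemma integral_law_nonneg {N : Measure ℕ} {ρ : Measure ℝ} (hρ : ρ (Iio 0) = 0) (p : ℝ)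
    (n : ℕ) :
    0 ≤ ∫ x, x ∂law N ρ p n :=
  integral_nonneg_of_ae (ae_nonneg (law_Iio_zero N hρ p n))

lemma normalizedMean_nonneg {N : Measure ℕ} {ρ : Measure ℝ} (hm : 1 < mean N) (hρ : ρ (Iio 0) = 0) (p : ℝ)
    (n : ℕ) :
    0 ≤ normalizedMean N ρ p n :=
  div_nonneg (integral_law_nonneg hρ p n) (pow_nonneg (by linarith) n)

section FreeEnergy

variable {N : Measure ℕ} [IsProbabilityMeasure N] {ρ : Measure ℝ} [IsProbabilityMeasure ρ]

lemma lintegral_ofReal_law_lt_top (hm : 1 < mean N) (hρ : ρ (Iio 0) = 0)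
    (hρ1 : ∫⁻ x, ENNReal.ofReal x ∂ρ < ∞) (p : Icc (0 : ℝ) 1) (n : ℕ) :
    ∫⁻ x, ENNReal.ofReal x ∂law N ρ p n < ∞ := by
  induction n with
  | zero =>
    rw [law, lintegral_initialLaw]
    simpa using ENNReal.mul_lt_top ENNReal.ofReal_lt_top hρ1
  | succ n ih =>
    exact (lintegral_ofReal_step_le hm (law_Iio_zero N hρ p n)).trans_lt
      (ENNReal.mul_lt_top ENNReal.ofReal_lt_top ih)

lemma integrable_law (hm : 1 < mean N) (hρ : ρ (Iio 0) = 0)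
    (hρ1 : ∫⁻ x, ENNReal.ofReal x ∂ρ < ∞) (p : Icc (0 : ℝ) 1) (n : ℕ) :
    Integrable (fun x : ℝ => x) (law N ρ p n) := by
  refine ⟨by fun_prop, ?_⟩
  rw [hasFiniteIntegral_iff_ofReal (ae_nonneg (law_Iio_zero N hρ p n))]
  exact lintegral_ofReal_law_lt_top hm hρ hρ1 p n

lemma ofReal_integral_law (hm : 1 < mean N) (hρ : ρ (Iio 0) = 0)
    (hρ1 : ∫⁻ x, ENNReal.ofReal x ∂ρ < ∞) (p : Icc (0 : ℝ) 1) (n : ℕ) :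
    ENNReal.ofReal (∫ x, x ∂law N ρ p n) = ∫⁻ x, ENNReal.ofReal x ∂law N ρ p n :=
  ofReal_integral_eq_lintegral_ofReal (integrable_law hm hρ hρ1 p n)
    (ae_nonneg (law_Iio_zero N hρ p n))

lemma integral_law_succ_le (hm : 1 < mean N) (hρ : ρ (Iio 0) = 0)
    (hρ1 : ∫⁻ x, ENNReal.ofReal x ∂ρ < ∞) (p : Icc (0 : ℝ) 1) (n : ℕ) :
    ∫ x, x ∂law N ρ p (n + 1) ≤ mean N * ∫ x, x ∂law N ρ p n := by
  have h0 := integral_law_nonneg (N := N) hρ p n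
  rw [← ENNReal.ofReal_le_ofReal_iff (by positivity), ENNReal.ofReal_mul (by linarith),
    ofReal_integral_law hm hρ hρ1, ofReal_integral_law hm hρ hρ1]
  exact lintegral_ofReal_step_le hm (law_Iio_zero N hρ p n)

lemma le_integral_law_succ (hm : 1 < mean N) (hρ : ρ (Iio 0) = 0)
    (hρ1 : ∫⁻ x, ENNReal.ofReal x ∂ρ < ∞) (p : Icc (0 : ℝ) 1) (n : ℕ) :
    mean N * ∫ x, x ∂law N ρ p n ≤ ∫ x, x ∂law N ρ p (n + 1) + 1 := by
  have h0 := integral_law_nonneg (N := N) hρ p (n + 1)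
  rw [← ENNReal.ofReal_le_ofReal_iff (by positivity), ENNReal.ofReal_mul (by linarith),
    ENNReal.ofReal_add h0 zero_le_one,
    ofReal_integral_law hm hρ hρ1, ofReal_integral_law hm hρ hρ1, ENNReal.ofReal_one]
  exact le_lintegral_ofReal_step hm (law_Iio_zero N hρ p n)

lemma antitone_normalizedMean (hm : 1 < mean N) (hρ : ρ (Iio 0) = 0)
    (hρ1 : ∫⁻ x, ENNReal.ofReal x ∂ρ < ∞) (p : Icc (0 : ℝ) 1) :
    Antitone (normalizedMean N ρ p) := by
  refine antitone_nat_of_succ_le fun n => ?_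
  have hm0 : 0 < mean N := by linarith
  rw [normalizedMean, normalizedMean, div_le_div_iff₀ (by positivity) (by positivity), pow_succ]
  have := mul_le_mul_of_nonneg_right (integral_law_succ_le hm hρ hρ1 p n)
    (pow_nonneg hm0.le n)
  linarith

lemma tendsto_normalizedMean (hm : 1 < mean N) (hρ : ρ (Iio 0) = 0)
    (hρ1 : ∫⁻ x, ENNReal.ofReal x ∂ρ < ∞) (p : Icc (0 : ℝ) 1) :
    Tendsto (normalizedMean N ρ p) atTop (𝓝 (freeEnergy N ρ p)) :=
  tendsto_nhds_limUnder ⟨_, tendsto_atTop_ciInf (antitone_normalizedMean hm hρ hρ1 p)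
    ⟨0, by rintro _ ⟨n, rfl⟩; exact normalizedMean_nonneg hm hρ p n⟩⟩

lemma freeEnergy_le_normalizedMean (hm : 1 < mean N) (hρ : ρ (Iio 0) = 0)
    (hρ1 : ∫⁻ x, ENNReal.ofReal x ∂ρ < ∞) (p : Icc (0 : ℝ) 1) (n : ℕ) :
    freeEnergy N ρ p ≤ normalizedMean N ρ p n :=
  (antitone_normalizedMean hm hρ hρ1 p).le_of_tendsto (tendsto_normalizedMean hm hρ hρ1 p) n

/-- Since `E(X_{n+1}) ≥ m E(X_n) - 1`, the excess of `E(X_n)` over `1 / (m - 1)` is multiplied by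
at least `m` in each step. -/
lemma le_freeEnergy (hm : 1 < mean N) (hρ : ρ (Iio 0) = 0)
    (hρ1 : ∫⁻ x, ENNReal.ofReal x ∂ρ < ∞) (p : Icc (0 : ℝ) 1) (n : ℕ) :
    (∫ x, x ∂law N ρ p n - 1 / (mean N - 1)) / mean N ^ n ≤ freeEnergy N ρ p := by
  have hm0 : 0 < mean N := by linarith
  have hm1 : 0 < mean N - 1 := by linarith
  have key : ∀ j, (∫ x, x ∂law N ρ p n - 1 / (mean N - 1)) / mean N ^ n
      ≤ (∫ x, x ∂law N ρ p (n + j) - 1 / (mean N - 1)) / mean N ^ (n + j) := by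
    intro j
    induction j with
    | zero => simp
    | succ j ih =>
      refine ih.trans ?_
      rw [← add_assoc, div_le_div_iff₀ (by positivity) (by positivity), pow_succ]
      have h1 := le_integral_law_succ hm hρ hρ1 p (n + j)
      have h2 : mean N * (1 / (mean N - 1)) = 1 / (mean N - 1) + 1 := by field_simp; ring
      have h3 : mean N * (∫ x, x ∂law N ρ p (n + j) - 1 / (mean N - 1))
          ≤ ∫ x, x ∂law N ρ p (n + j + 1) - 1 / (mean N - 1) := by
        rw [mul_sub, h2]; linarith
      have := mul_le_mul_of_nonneg_right h3 (pow_nonneg hm0.le (n + j))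
      linarith
  refine ge_of_tendsto ((tendsto_normalizedMean hm hρ hρ1 p).comp (tendsto_add_atTop_nat n))
    (Eventually.of_forall fun j => ?_)
  refine (key j).trans ?_
  simp only [Function.comp, normalizedMean]
  rw [add_comm j n]
  gcongr
  have : 0 < 1 / (mean N - 1) := by positivity
  linarith

end FreeEnergy

/-! ### Stochastic domination with an error -/

/-- The test functions for stochastic domination: nondecreasing and `1`-Lipschitz. -/
structure IsTest (φ : ℝ → ℝ≥0∞) : Prop where
  mono : Monotone φ
  lip : ∀ x y, x ≤ y → φ y ≤ φ x + ENNReal.ofReal (y - x)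

namespace IsTest

lemma measurable {φ : ℝ → ℝ≥0∞} (h : IsTest φ) : Measurable φ := h.mono.measurable

lemma shift {φ : ℝ → ℝ≥0∞} (h : IsTest φ) (y : ℝ) : IsTest fun s => φ (y + s) :=
  ⟨fun _ _ hab => h.mono (by linarith),
    fun a b hab => by simpa using h.lip (y + a) (y + b) (by linarith)⟩

lemma comp_max {φ : ℝ → ℝ≥0∞} (h : IsTest φ) : IsTest fun s => φ (max (s - 1) 0) := by
  have hmono : Monotone fun s : ℝ => max (s - 1) 0 := fun a b hab =>
    max_le_max (by linarith) le_rfl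
  refine ⟨h.mono.comp hmono, fun a b hab => (h.lip _ _ (hmono hab)).trans
    (add_le_add le_rfl (ENNReal.ofReal_le_ofReal ?_))⟩
  rcases max_cases (b - 1) (0 : ℝ) with hb | hb <;> rcases max_cases (a - 1) (0 : ℝ) with ha | ha <;>
    simp only [hb.1, ha.1] <;> linarith

lemma ofReal : IsTest ENNReal.ofReal :=
  ⟨ENNReal.ofReal_mono, fun x y _ => by
    calc ENNReal.ofReal y = ENNReal.ofReal (x + (y - x)) := by ring_nf
      _ ≤ _ := ENNReal.ofReal_add_le⟩

lemma ofReal_min_sub (a : ℝ) : IsTest fun x => ENNReal.ofReal (min (x - a) 1) := by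
  refine ⟨fun x y h => ENNReal.ofReal_mono (min_le_min (by linarith) le_rfl), fun x y h => ?_⟩
  refine le_trans (ENNReal.ofReal_le_ofReal ?_) ENNReal.ofReal_add_le
  rcases min_cases (y - a) (1 : ℝ) with hb | hb <;> rcases min_cases (x - a) (1 : ℝ) with ha | ha <;>
    simp only [hb.1, ha.1] <;> linarith

lemma sub_const {φ : ℝ → ℝ≥0∞} (h : IsTest φ) (c : ℝ≥0∞) : IsTest fun s => φ s - c := by
  refine ⟨fun a b hab => tsub_le_tsub_right (h.mono hab) c, fun a b hab => ?_⟩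
  rw [tsub_le_iff_right]
  calc φ b ≤ φ a + ENNReal.ofReal (b - a) := h.lip a b hab
    _ ≤ (φ a - c + c) + ENNReal.ofReal (b - a) := by gcongr; exact le_tsub_add
    _ = _ := by ring

end IsTest

/-- `P` is stochastically dominated by `Q` up to the error `e`. With `e = 0` this holds if `P ≤ Q`
stochastically; a positive error allows for a modification of the law at a small transport cost. -/
def Dominated (e : ℝ≥0∞) (P Q : Measure ℝ) : Prop :=
  ∀ φ, IsTest φ → ∫⁻ x, φ x ∂P ≤ ∫⁻ x, φ x ∂Q + e

lemma Dominated.sumLaw {e : ℝ≥0∞} {P Q : Measure ℝ} [IsProbabilityMeasure P]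
    [IsProbabilityMeasure Q] (h : Dominated e P Q) (k : ℕ) :
    Dominated (k * e) (sumLaw P k) (sumLaw Q k) := by
  induction k with
  | zero =>
    intro φ hφ
    rw [lintegral_sumLaw_zero P hφ.measurable, lintegral_sumLaw_zero Q hφ.measurable]
    simp
  | succ k ih =>
    intro φ hφ
    have := hφ.measurable
    calc ∫⁻ s, φ s ∂DerridaRetaux.sumLaw P (k + 1)
        = ∫⁻ y, ∫⁻ s, φ (y + s) ∂DerridaRetaux.sumLaw P k ∂P := lintegral_sumLaw_succ P k this
      _ ≤ ∫⁻ y, (∫⁻ s, φ (y + s) ∂DerridaRetaux.sumLaw Q k + k * e) ∂P :=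
          lintegral_mono fun y => ih _ (hφ.shift y)
      _ = ∫⁻ y, ∫⁻ s, φ (y + s) ∂DerridaRetaux.sumLaw Q k ∂P + k * e := by
          rw [lintegral_add_right _ measurable_const]; simp
      _ = ∫⁻ s, ∫⁻ y, φ (s + y) ∂P ∂DerridaRetaux.sumLaw Q k + k * e := by
          rw [lintegral_lintegral_swap (Measurable.aemeasurable (by fun_prop))]
          simp only [add_comm]
      _ ≤ ∫⁻ s, (∫⁻ y, φ (s + y) ∂Q + e) ∂DerridaRetaux.sumLaw Q k + k * e := by
          gcongr with s
          exact h _ (hφ.shift s)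
      _ = ∫⁻ s, φ s ∂DerridaRetaux.sumLaw Q (k + 1) + (k + 1 : ℕ) * e := by
          rw [lintegral_add_right _ measurable_const, lintegral_sumLaw_succ' Q k this]
          simp only [lintegral_const, measure_univ, mul_one, add_comm _ (_ : ℝ)]
          push_cast
          ring

lemma Dominated.step {N : Measure ℕ} (hm : 1 < mean N) {e : ℝ≥0∞} {P Q : Measure ℝ}
    [IsProbabilityMeasure P] [IsProbabilityMeasure Q] (h : Dominated e P Q) :
    Dominated (ENNReal.ofReal (mean N) * e) (step N P) (step N Q) := by
  intro φ hφ
  rw [lintegral_step N P hφ.measurable, lintegral_step N Q hφ.measurable, ← lintegral_natCast hm,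
    ← lintegral_mul_const _ Measurable.of_discrete, ← lintegral_add_left Measurable.of_discrete]
  exact lintegral_mono fun k => h.sumLaw k _ hφ.comp_max

lemma Dominated.law {N : Measure ℕ} [IsProbabilityMeasure N] (hm : 1 < mean N) {e : ℝ≥0∞}
    {ρ ρ' : Measure ℝ} [IsProbabilityMeasure ρ] [IsProbabilityMeasure ρ'] (h : Dominated e ρ ρ')
    (p : Icc (0 : ℝ) 1) (n : ℕ) :
    Dominated (ENNReal.ofReal (mean N) ^ n * e) (law N ρ p n) (law N ρ' p n) := by
  induction n with
  | zero =>
    intro φ hφ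
    rw [DerridaRetaux.law, DerridaRetaux.law, lintegral_initialLaw, lintegral_initialLaw, add_assoc]
    gcongr
    calc ENNReal.ofReal p * ∫⁻ x, φ x ∂ρ ≤ ENNReal.ofReal p * (∫⁻ x, φ x ∂ρ' + e) := by
          gcongr; exact h φ hφ
      _ ≤ _ := by
          rw [mul_add]
          gcongr
          simpa using p.2.2
  | succ n ih =>
    rw [pow_succ', mul_assoc]
    exact ih.step hm

/-! ### Minorants of a law -/

/-- `r` is a minorant of `P`: moving the mass of `P` outside `r` to `0` decreases `P`
stochastically. -/
def IsMinorant (r P : Measure ℝ) : Prop :=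
  ∀ φ, IsTest φ → φ 0 = 0 → ∫⁻ x, φ x ∂r ≤ ∫⁻ x, φ x ∂P

lemma IsMinorant.dominated {r P : Measure ℝ} [IsProbabilityMeasure P] (hP : P (Iio 0) = 0)
    (h : IsMinorant r P) {u : ℝ≥0∞} (hu : u + r univ = 1) :
    Dominated 0 (u • Measure.dirac 0 + r) P := by
  intro φ hφ
  rw [lintegral_add_measure, lintegral_smul_measure, lintegral_dirac, add_zero]
  calc u • φ 0 + ∫⁻ x, φ x ∂r ≤ u • φ 0 + ∫⁻ x, (φ x - φ 0 + φ 0) ∂r := by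
        gcongr; exact le_tsub_add
    _ = φ 0 + ∫⁻ x, (φ x - φ 0) ∂r := by
        rw [lintegral_add_right _ measurable_const, lintegral_const, smul_eq_mul]
        calc u * φ 0 + (∫⁻ x, (φ x - φ 0) ∂r + φ 0 * r univ)
            = (u + r univ) * φ 0 + ∫⁻ x, (φ x - φ 0) ∂r := by ring
          _ = _ := by rw [hu, one_mul]
    _ ≤ φ 0 + ∫⁻ x, (φ x - φ 0) ∂P := by
        exact add_le_add le_rfl (h (fun x => φ x - φ 0) (hφ.sub_const _) (tsub_self _))
    _ = ∫⁻ x, (φ x - φ 0 + φ 0) ∂P := by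
        rw [lintegral_add_right _ measurable_const, lintegral_const, measure_univ, mul_one, add_comm]
    _ = ∫⁻ x, φ x ∂P := by
        refine lintegral_congr_ae ?_
        filter_upwards [ae_nonneg hP] with x hx
        exact tsub_add_cancel_of_le (hφ.mono hx)

/-- Among `ℓ` independent variables of law `u δ_0 + r`, keep only the events that at most two of
them are drawn from `r`. -/
lemma le_lintegral_sumLaw {u : ℝ≥0∞} {r : Measure ℝ} [IsFiniteMeasure r]
    [IsProbabilityMeasure (u • Measure.dirac 0 + r)] (ℓ : ℕ) {ψ : ℝ → ℝ≥0∞} (hψ : Measurable ψ) :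
    u ^ ℓ * ψ 0 + ℓ * u ^ (ℓ - 1) * ∫⁻ x, ψ x ∂r
      + ℓ.choose 2 * u ^ (ℓ - 2) * ∫⁻ x, ∫⁻ y, ψ (x + y) ∂r ∂r
      ≤ ∫⁻ s, ψ s ∂sumLaw (u • Measure.dirac 0 + r) ℓ := by
  induction ℓ generalizing ψ with
  | zero => rw [lintegral_sumLaw_zero _ hψ]; simp
  | succ ℓ ih =>
    rw [lintegral_sumLaw_succ _ _ hψ, lintegral_add_measure, lintegral_smul_measure,
      lintegral_dirac' _ (by fun_prop)]
    simp only [zero_add, smul_eq_mul]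
    have h1 : u * (u ^ ℓ * ψ 0 + ℓ * u ^ (ℓ - 1) * ∫⁻ x, ψ x ∂r
        + ℓ.choose 2 * u ^ (ℓ - 2) * ∫⁻ x, ∫⁻ y, ψ (x + y) ∂r ∂r)
        ≤ u * ∫⁻ s, ψ s ∂sumLaw (u • Measure.dirac 0 + r) ℓ := by
      gcongr; exact ih hψ
    have h2 : u ^ ℓ * ∫⁻ y, ψ y ∂r + ℓ * u ^ (ℓ - 1) * ∫⁻ y, ∫⁻ x, ψ (y + x) ∂r ∂r
        ≤ ∫⁻ y, ∫⁻ s, ψ (y + s) ∂sumLaw (u • Measure.dirac 0 + r) ℓ ∂r := by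
      rw [← lintegral_const_mul _ hψ, ← lintegral_const_mul _ (by fun_prop),
        ← lintegral_add_left (by fun_prop)]
      refine lintegral_mono fun y => ?_
      refine le_trans ?_ (ih (ψ := fun s => ψ (y + s)) (by fun_prop))
      simp
    refine le_trans (le_of_eq ?_) (add_le_add h1 h2)
    have e1 : u * (ℓ * u ^ (ℓ - 1)) = ℓ * u ^ ℓ := by
      cases ℓ with
      | zero => simp
      | succ n => simp only [Nat.add_sub_cancel, pow_succ]; ring
    have e2 : u * (ℓ.choose 2 * u ^ (ℓ - 2)) = ℓ.choose 2 * u ^ (ℓ - 1) := by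
      rcases ℓ with _ | _ | n
      · simp
      · simp
      · simp only [Nat.add_sub_cancel, show n + 1 + 1 - 2 = n by omega, pow_succ]; ring
    have e3 : ((ℓ + 1).choose 2 : ℝ≥0∞) = ℓ + ℓ.choose 2 := by
      rw [Nat.choose_succ_succ' ℓ 1]; simp
    rw [e3, show ℓ + 1 - 1 = ℓ by omega, show ℓ + 1 - 2 = ℓ - 1 by omega]
    rw [mul_add, mul_add, ← mul_assoc u (ℓ * _), e1, ← mul_assoc u (ℓ.choose 2 * _), e2, pow_succ]
    push_cast
    ring

/-- The effect of one step on a minorant: `X_{n+1}` is at least `X_{n,i} - 1` if a single term is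
drawn from the minorant, and `X_{n,i} + X_{n,j} - 1` if exactly two terms are. -/
lemma IsMinorant.le_lintegral_step {N : Measure ℕ} [IsProbabilityMeasure N] (hm : 1 < mean N)
    {r P : Measure ℝ} [IsFiniteMeasure r] [IsProbabilityMeasure P]
    (hP : P (Iio 0) = 0) (h : IsMinorant r P) {u : ℝ≥0∞} (hu : u + r univ = 1)
    {φ : ℝ → ℝ≥0∞} (hφ : IsTest φ) :
    (∫⁻ ℓ, ℓ * u ^ (ℓ - 1) ∂N) * ∫⁻ x, φ (max (x - 1) 0) ∂r
      + (∫⁻ ℓ, ℓ.choose 2 * u ^ (ℓ - 2) ∂N) * ∫⁻ x, ∫⁻ y, φ (max (x + y - 1) 0) ∂r ∂r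
      ≤ ∫⁻ x, φ x ∂step N P := by
  have : IsProbabilityMeasure (u • Measure.dirac 0 + r) := ⟨by simpa using hu⟩
  have h1 := (h.dominated hP hu).step hm φ hφ
  rw [mul_zero, add_zero] at h1
  refine le_trans ?_ h1
  rw [lintegral_step N _ hφ.measurable, ← lintegral_mul_const _ Measurable.of_discrete,
    ← lintegral_mul_const _ Measurable.of_discrete, ← lintegral_add_left Measurable.of_discrete]
  refine lintegral_mono fun ℓ => ?_
  refine le_trans ?_ (le_lintegral_sumLaw ℓ hφ.comp_max.measurable)
  rw [add_assoc]
  exact le_add_self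

/-! ### Moments of `ν` -/

lemma integrable_sq_mul_pow {N : Measure ℕ} {t : ℝ} (ht : Integrable (fun k : ℕ => t ^ k) N)
    {s : ℝ} (hs : 0 ≤ s) (hst : s < t) : Integrable (fun k : ℕ => (k : ℝ) ^ 2 * s ^ k) N := by
  have ht0 : 0 < t := hs.trans_lt hst
  have h := tendsto_pow_const_mul_const_pow_of_abs_lt_one 2 (r := s / t)
    (by rw [abs_of_nonneg (by positivity), div_lt_one ht0]; exact hst)
  obtain ⟨C, hC⟩ := h.bddAbove_range
  refine (ht.const_mul C).mono' (by fun_prop) (ae_of_all _ fun k => ?_)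
  have hk : (k : ℝ) ^ 2 * (s / t) ^ k ≤ C := hC ⟨k, rfl⟩
  rw [Real.norm_of_nonneg (by positivity)]
  calc (k : ℝ) ^ 2 * s ^ k = (k : ℝ) ^ 2 * (s / t) ^ k * t ^ k := by
        rw [div_pow]; field_simp
    _ ≤ C * t ^ k := by gcongr

lemma integrable_sq {N : Measure ℕ}
    (hexp : ∃ t : ℝ, 1 < t ∧ Integrable (fun k : ℕ => t ^ k) N) :
    Integrable (fun k : ℕ => (k : ℝ) ^ 2) N := by
  obtain ⟨t, ht1, ht⟩ := hexp
  simpa using integrable_sq_mul_pow ht zero_le_one ht1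

/-- `E(ν u^(ν-1)) ≥ m - E(ν²) (1 - u)`, by Bernoulli's inequality. -/
lemma le_lintegral_mul_pow {N : Measure ℕ} (hm : 1 < mean N)
    (h2 : Integrable (fun k : ℕ => (k : ℝ) ^ 2) N) {θ : ℝ} (h0 : 0 ≤ θ) (h1 : θ ≤ 1) :
    ENNReal.ofReal (mean N - (∫ k, (k : ℝ) ^ 2 ∂N) * θ) ≤
      ∫⁻ k, k * ENNReal.ofReal (1 - θ) ^ (k - 1) ∂N := by
  have hi := integrable_natCast hm
  have hint : Integrable (fun k : ℕ => (k : ℝ) * (1 - θ) ^ (k - 1)) N := by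
    refine hi.mono' (by fun_prop) (ae_of_all _ fun k => ?_)
    have := pow_nonneg (sub_nonneg.2 h1) (k - 1)
    rw [Real.norm_of_nonneg (by positivity)]
    exact mul_le_of_le_one_right (by positivity) (pow_le_one₀ (by linarith) (by linarith))
  have e : ∫⁻ k, k * ENNReal.ofReal (1 - θ) ^ (k - 1) ∂N
      = ENNReal.ofReal (∫ k, (k : ℝ) * (1 - θ) ^ (k - 1) ∂N) := by
    rw [ofReal_integral_eq_lintegral_ofReal hint (ae_of_all _ fun k =>
      mul_nonneg (Nat.cast_nonneg k) (pow_nonneg (sub_nonneg.2 h1) _))]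
    refine lintegral_congr fun k => ?_
    rw [ENNReal.ofReal_mul (by positivity), ENNReal.ofReal_pow (by linarith)]
    simp
  rw [e]
  refine ENNReal.ofReal_le_ofReal ?_
  rw [mean, ← integral_mul_const, ← integral_sub hi (h2.mul_const _)]
  refine integral_mono (hi.sub (h2.mul_const _)) hint fun k => ?_
  have hb := one_add_mul_le_pow (a := -θ) (by linarith) (k - 1)
  rcases k with _ | k
  · simp
  · simp only [Nat.add_sub_cancel] at hb ⊢
    push_cast at hb ⊢
    have : ((k : ℝ) + 1) * (1 + k * -θ) ≤ ((k : ℝ) + 1) * (1 + -θ) ^ k := by gcongr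
    rw [← sub_eq_add_neg] at this
    nlinarith

/-- `E(C(ν,2) u^(ν-2))` is bounded below for `u ≥ 1/2`, since `P(ν ≥ 2) > 0`. -/
lemma exists_le_lintegral_choose {N : Measure ℕ} [IsProbabilityMeasure N] (hm : 1 < mean N) :
    ∃ c : ℝ, 0 < c ∧ ∀ θ : ℝ, θ ≤ 1 / 2 →
      ENNReal.ofReal c ≤ ∫⁻ k, k.choose 2 * ENNReal.ofReal (1 - θ) ^ (k - 2) ∂N := by
  obtain ⟨k, hk2, hk⟩ : ∃ k, 2 ≤ k ∧ N {k} ≠ 0 := by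
    by_contra! hcon
    have h0 : N {k | 2 ≤ k} = 0 := by
      rw [← Set.biUnion_of_singleton {k | 2 ≤ k}, measure_biUnion_null_iff (to_countable _)]
      exact hcon
    have : mean N ≤ ∫ _, (1 : ℝ) ∂N := by
      refine integral_mono_ae (integrable_natCast hm) (integrable_const _) ?_
      have : ∀ᵐ k ∂N, ¬ 2 ≤ k := by rw [ae_iff]; simpa only [not_not] using h0
      filter_upwards [this] with k hk
      have : k ≤ 1 := by omega
      exact_mod_cast this
    simp at this
    linarith
  have hfin : N {k} ≠ ∞ := measure_ne_top _ _
  refine ⟨(1 / 2) ^ (k - 2) * (N {k}).toReal,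
    mul_pos (by positivity) (ENNReal.toReal_pos hk hfin), fun θ hθ => ?_⟩
  calc ENNReal.ofReal ((1 / 2) ^ (k - 2) * (N {k}).toReal)
      = ENNReal.ofReal (1 / 2) ^ (k - 2) * N {k} := by
        rw [ENNReal.ofReal_mul (by positivity), ENNReal.ofReal_pow (by positivity),
          ENNReal.ofReal_toReal hfin]
    _ ≤ (k.choose 2 * ENNReal.ofReal (1 - θ) ^ (k - 2)) * N {k} := by
        gcongr
        calc ENNReal.ofReal (1 / 2) ^ (k - 2) ≤ 1 * ENNReal.ofReal (1 - θ) ^ (k - 2) := by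
              rw [one_mul]; gcongr; linarith
          _ ≤ _ := by
              gcongr
              exact_mod_cast Nat.choose_pos hk2
    _ = ∫⁻ j in {k}, j.choose 2 * ENNReal.ofReal (1 - θ) ^ (j - 2) ∂N := by
        rw [lintegral_singleton]
    _ ≤ _ := setLIntegral_le_lintegral _ _

/-! ### Once a tail is large, the system is supercritical -/

lemma sumLaw_Iio_le {P : Measure ℝ} [IsProbabilityMeasure P] (hP : P (Iio 0) = 0) (a : ℝ)
    (ℓ : ℕ) : sumLaw P ℓ (Iio a) ≤ P (Iio a) ^ ℓ := by
  have hind : Measurable (indicator (Iio a) (1 : ℝ → ℝ≥0∞)) :=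
    measurable_one.indicator measurableSet_Iio
  induction ℓ with
  | zero => simpa using prob_le_one
  | succ ℓ ih =>
    rw [← lintegral_indicator_one measurableSet_Iio, lintegral_sumLaw_succ P ℓ hind]
    calc ∫⁻ y, ∫⁻ s, indicator (Iio a) 1 (y + s) ∂sumLaw P ℓ ∂P
        ≤ ∫⁻ y, ∫⁻ s, indicator (Iio a) 1 y * indicator (Iio a) 1 s ∂sumLaw P ℓ ∂P := by
          refine lintegral_mono_ae ?_
          filter_upwards [ae_nonneg hP] with y hy
          refine lintegral_mono_ae ?_
          filter_upwards [ae_nonneg (sumLaw_Iio_zero hP ℓ)] with s hs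
          by_cases h : y + s < a
          · have h1 : y < a := by linarith
            have h2 : s < a := by linarith
            simp [indicator, h1, h2, h]
          · simp [indicator, h]
      _ = P (Iio a) * sumLaw P ℓ (Iio a) := by
          simp_rw [lintegral_const_mul _ hind, lintegral_mul_const _ hind,
            lintegral_indicator_one measurableSet_Iio]
      _ ≤ _ := by rw [pow_succ']; gcongr

lemma one_sub_pow_le {q : ℝ} (h0 : 0 ≤ q) (h1 : q ≤ 1) (k : ℕ) :
    (1 - q) ^ k ≤ 1 - k * q + k ^ 2 * q ^ 2 := by
  induction k with
  | zero => simp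
  | succ k ih =>
    rw [pow_succ]
    have := mul_le_mul_of_nonneg_right ih (sub_nonneg.2 h1)
    push_cast
    have hk : (0 : ℝ) ≤ k := Nat.cast_nonneg k
    nlinarith [mul_nonneg (mul_nonneg hk hk) (pow_nonneg h0 3), mul_nonneg hk (pow_nonneg h0 2),
      pow_nonneg h0 2]

/-- The maximum of `ν` independent copies already has a tail almost `m` times as large. -/
lemma le_step_Ici {N : Measure ℕ} [IsProbabilityMeasure N] (hm : 1 < mean N)
    (h2 : Integrable (fun k : ℕ => (k : ℝ) ^ 2) N) {P : Measure ℝ} [IsProbabilityMeasure P]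
    (hP : P (Iio 0) = 0) {a q : ℝ} (h0 : 0 ≤ q) (h1 : q ≤ 1) (hq : q ≤ P.real (Ici a)) :
    mean N * q - (∫ k, (k : ℝ) ^ 2 ∂N) * q ^ 2 ≤ (step N P).real (Ici (a - 1)) := by
  have hi := integrable_natCast hm
  have hP1 : P (Iio a) ≤ ENNReal.ofReal (1 - q) := by
    have : P.real (Iio a) ≤ 1 - q := by
      rw [← compl_Ici, probReal_compl_eq_one_sub measurableSet_Ici]
      linarith
    rw [← ofReal_measureReal]
    exact ENNReal.ofReal_le_ofReal this
  have hint : Integrable (fun k : ℕ => 1 - (k : ℝ) * q + (k : ℝ) ^ 2 * q ^ 2) N :=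
    ((integrable_const _).sub (hi.mul_const q)).add (h2.mul_const _)
  have hnn : ∀ k : ℕ, 0 ≤ 1 - (k : ℝ) * q + (k : ℝ) ^ 2 * q ^ 2 := fun k =>
    (pow_nonneg (sub_nonneg.2 h1) k).trans (one_sub_pow_le h0 h1 k)
  have hle : step N P (Iio (a - 1)) ≤
      ENNReal.ofReal (∫ k, (1 - (k : ℝ) * q + (k : ℝ) ^ 2 * q ^ 2) ∂N) := by
    rw [ofReal_integral_eq_lintegral_ofReal hint (ae_of_all _ hnn),
      ← lintegral_indicator_one measurableSet_Iio,
      lintegral_step N P (measurable_one.indicator measurableSet_Iio)]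
    refine lintegral_mono fun k => ?_
    calc ∫⁻ s, indicator (Iio (a - 1)) 1 (max (s - 1) 0) ∂sumLaw P k
        ≤ ∫⁻ s, indicator (Iio a) 1 s ∂sumLaw P k := by
          refine lintegral_mono fun s => ?_
          by_cases h : max (s - 1) 0 < a - 1
          · have : s < a := by linarith [le_max_left (s - 1) 0]
            simp [indicator, this]
            split_ifs <;> simp
          · simp only [indicator, mem_Iio, h, if_false]
            exact zero_le
      _ ≤ P (Iio a) ^ k := by
          rw [lintegral_indicator_one measurableSet_Iio]; exact sumLaw_Iio_le hP a k
      _ ≤ ENNReal.ofReal (1 - q) ^ k := by gcongr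
      _ ≤ _ := by
          rw [← ENNReal.ofReal_pow (by linarith)]
          exact ENNReal.ofReal_le_ofReal (one_sub_pow_le h0 h1 k)
  have hI : ∫ k, (1 - (k : ℝ) * q + (k : ℝ) ^ 2 * q ^ 2) ∂N
      = 1 - mean N * q + (∫ k, (k : ℝ) ^ 2 ∂N) * q ^ 2 := by
    have h1q : Integrable (fun k : ℕ => 1 - (k : ℝ) * q) N :=
      (integrable_const _).sub (hi.mul_const q)
    rw [integral_add h1q (h2.mul_const _), integral_sub (integrable_const _) (hi.mul_const q), integral_mul_const, integral_mul_const]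
    simp [mean]
  have h3 : (step N P).real (Iio (a - 1)) ≤ 1 - mean N * q + (∫ k, (k : ℝ) ^ 2 ∂N) * q ^ 2 := by
    rw [← hI]
    exact ENNReal.toReal_le_of_le_ofReal (integral_nonneg hnn) hle
  rw [← compl_Ici, probReal_compl_eq_one_sub measurableSet_Ici] at h3
  linarith

lemma mean_le_integral_sq {N : Measure ℕ} (hm : 1 < mean N)
    (h2 : Integrable (fun k : ℕ => (k : ℝ) ^ 2) N) : mean N ≤ ∫ k, (k : ℝ) ^ 2 ∂N := by
  refine integral_mono (integrable_natCast hm) h2 fun k => ?_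
  rcases Nat.eq_zero_or_pos k with h | h
  · simp [h]
  · have : (1 : ℝ) ≤ k := by exact_mod_cast h
    simp only
    nlinarith

/-- If `X_n ≥ k` has probability at least `C m^{-k}` for one `k` that is not too small, then the
maximum over the `m^{k-R}` particles that merge in the following `k - R` steps shows that
`E(X_{n+k-R})` is large. The probabilities are controlled by the iterates of
`q ↦ m q - E(ν²) q²`, for which `x ↦ x / (1 + κ x)` conjugates multiplication by `m` to a
minorant. -/
lemma exists_le_freeEnergy_of_tail {N : Measure ℕ} [IsProbabilityMeasure N] (hm : 1 < mean N)
    (h2 : Integrable (fun k : ℕ => (k : ℝ) ^ 2) N) {ρ : Measure ℝ} [IsProbabilityMeasure ρ]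
    (hρ : ρ (Iio 0) = 0) (hρ1 : ∫⁻ x, ENNReal.ofReal x ∂ρ < ∞) :
    ∃ (R : ℕ) (C : ℝ), 0 < C ∧ ∀ (p : Icc (0 : ℝ) 1) (n k : ℕ), R ≤ k →
      C / mean N ^ k ≤ (law N ρ p n).real (Ici (k : ℝ)) →
      1 / mean N ^ (n + k) ≤ freeEnergy N ρ p := by
  set m := mean N with hmdef
  set V := ∫ k, (k : ℝ) ^ 2 ∂N with hV
  have hmV : m ≤ V := mean_le_integral_sq hm h2
  have hm1 : 0 < m - 1 := by linarith
  have hm0 : 0 < m := by linarith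
  set κ := V / (m - 1) with hκ
  have hκ1 : 1 ≤ κ := by rw [hκ, le_div_iff₀ hm1]; linarith
  have hκV : κ * (m - 1) = V := by rw [hκ]; field_simp
  set h : ℝ → ℝ := fun x => x / (1 + κ * x) with hh
  have hh1 : ∀ x, 0 ≤ x → h x ≤ 1 := fun x hx => by
    rw [hh, div_le_one (by positivity)]; nlinarith
  have hh0 : ∀ x, 0 ≤ x → 0 ≤ h x := fun x hx => by rw [hh]; positivity
  have hstep : ∀ x, 0 ≤ x → h (m * x) ≤ m * h x - V * h x ^ 2 := by
    intro x hx
    have e : m * h x - V * h x ^ 2 = (m * x * (1 + κ * x) - V * x ^ 2) / (1 + κ * x) ^ 2 := by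
      simp only [hh]; field_simp
    rw [e]
    simp only [hh]
    rw [div_le_div_iff₀ (by positivity) (by positivity), ← hκV]
    have : (m * x * (1 + κ * x) - κ * (m - 1) * x ^ 2) * (1 + κ * (m * x))
        - m * x * (1 + κ * x) ^ 2 = κ * x ^ 2 * (m - 1) ^ 2 := by ring
    have : 0 ≤ κ * x ^ 2 * (m - 1) ^ 2 := by positivity
    linarith
  obtain ⟨R, hR⟩ := exists_nat_ge ((1 + κ) * (1 / (m - 1) + 1))
  refine ⟨R, m ^ R, by positivity, fun p n k hRk hk => ?_⟩
  have hchain : ∀ r : ℕ, h (m ^ r * (m ^ R / m ^ k)) ≤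
      (law N ρ p (n + r)).real (Ici ((k : ℝ) - r)) := by
    intro r
    induction r with
    | zero =>
      simp only [pow_zero, one_mul, add_zero, Nat.cast_zero, sub_zero]
      refine le_trans ?_ hk
      exact div_le_self (by positivity) (by linarith [show 0 ≤ κ * (m ^ R / m ^ k) by positivity])
    | succ r ih =>
      have hx : 0 ≤ m ^ r * (m ^ R / m ^ k) := by positivity
      have := le_step_Ici hm h2 (law_Iio_zero N hρ p (n + r)) (hh0 _ hx) (hh1 _ hx) ih
      rw [pow_succ', mul_assoc]
      refine (hstep _ hx).trans (this.trans (le_of_eq ?_))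
      push_cast
      rw [← add_assoc, law]
      congr 2
      ring
  obtain ⟨j, rfl⟩ := Nat.exists_eq_add_of_le hRk
  have h1 := hchain j
  have e1 : m ^ j * (m ^ R / m ^ (R + j)) = 1 := by rw [pow_add]; field_simp
  rw [e1] at h1
  simp only [hh, mul_one, Nat.cast_add, add_sub_cancel_right] at h1
  have hE : 1 / (m - 1) + 1 ≤ ∫ x, x ∂law N ρ p (n + j) := by
    have := mul_meas_ge_le_integral_of_nonneg (ae_nonneg (law_Iio_zero N hρ p (n + j)))
      (integrable_law hm hρ hρ1 p (n + j)) (R : ℝ)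
    refine le_trans ?_ this
    calc 1 / (m - 1) + 1 ≤ R * (1 / (1 + κ)) := by
          rw [mul_one_div, le_div_iff₀ (by linarith)]; linarith
      _ ≤ _ := by gcongr; exact h1
  refine le_trans ?_ (le_freeEnergy hm hρ hρ1 p (n + j))
  calc 1 / m ^ (n + (R + j)) ≤ 1 / m ^ (n + j) := by
        gcongr
        · exact hm.le
        · omega
    _ ≤ _ := by gcongr; linarith

/-! ### A minorant that keeps single survivors and mergers of pairs -/

/-- Start from the measure `r₀`; in each step keep a single particle with weight `A` and a pair of
particles with weight `B`, and discard what lies below `K`. -/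
noncomputable def minorantSeq (A B K : ℝ) (r₀ : Measure ℝ) : ℕ → Measure ℝ
  | 0 => r₀
  | n + 1 => (ENNReal.ofReal A • (minorantSeq A B K r₀ n).map (fun x => x - 1)
      + ENNReal.ofReal B • ((minorantSeq A B K r₀ n).prod (minorantSeq A B K r₀ n)).map
        (fun z : ℝ × ℝ => z.1 + z.2 - 1)).restrict (Ici K)

instance (A B K : ℝ) (r₀ : Measure ℝ) [IsFiniteMeasure r₀] (n : ℕ) :
    IsFiniteMeasure (minorantSeq A B K r₀ n) := by
  induction n with
  | zero => assumption
  | succ n ih =>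
    rw [minorantSeq]
    have h1 := Measure.smul_finite ((minorantSeq A B K r₀ n).map (fun x => x - 1))
      (ENNReal.ofReal_ne_top (r := A))
    have h2 := Measure.smul_finite (((minorantSeq A B K r₀ n).prod (minorantSeq A B K r₀ n)).map
        (fun z : ℝ × ℝ => z.1 + z.2 - 1)) (ENNReal.ofReal_ne_top (r := B))
    infer_instance

lemma minorantSeq_Iio (A B K : ℝ) {r₀ : Measure ℝ} (h : r₀ (Iio K) = 0) (n : ℕ) :
    minorantSeq A B K r₀ n (Iio K) = 0 := by
  cases n with
  | zero => exact h
  | succ n =>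
    have : Iio K ∩ Ici K = ∅ := by ext; simp
    rw [minorantSeq, Measure.restrict_apply measurableSet_Iio, this, measure_empty]

lemma IsMinorant.le_Ici {r P : Measure ℝ} (h : IsMinorant r P) {a : ℝ} (ha : 1 ≤ a) :
    r (Ici a) ≤ P (Ici (a - 1)) := by
  have h1 := h _ (IsTest.ofReal_min_sub (a - 1))
    (ENNReal.ofReal_of_nonpos ((min_le_left _ _).trans (by linarith)))
  calc r (Ici a) = ∫⁻ x, indicator (Ici a) 1 x ∂r := (lintegral_indicator_one measurableSet_Ici).symm
    _ ≤ ∫⁻ x, ENNReal.ofReal (min (x - (a - 1)) 1) ∂r := by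
        refine lintegral_mono fun x => ?_
        by_cases hx : a ≤ x
        · have : (1 : ℝ) ≤ x - (a - 1) := by linarith
          simp [indicator, hx, min_eq_right this]
        · simp [indicator, hx]
    _ ≤ _ := h1
    _ ≤ ∫⁻ x, indicator (Ici (a - 1)) 1 x ∂P := by
        refine lintegral_mono fun x => ?_
        by_cases hx : a - 1 ≤ x
        · simp [indicator, hx]
        · simp only [indicator, mem_Ici, hx, if_false]
          rw [ENNReal.ofReal_of_nonpos ((min_le_left _ _).trans (by linarith))]
    _ = P (Ici (a - 1)) := lintegral_indicator_one measurableSet_Ici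

lemma IsMinorant.succ {N : Measure ℕ} [IsProbabilityMeasure N] (hm : 1 < mean N)
    (h2 : Integrable (fun k : ℕ => (k : ℝ) ^ 2) N) {c : ℝ}
    (hc : ∀ θ : ℝ, θ ≤ 1 / 2 →
      ENNReal.ofReal c ≤ ∫⁻ k, k.choose 2 * ENNReal.ofReal (1 - θ) ^ (k - 2) ∂N)
    {A K : ℝ} {r₀ P : Measure ℝ} [IsFiniteMeasure r₀] [IsProbabilityMeasure P]
    (hP : P (Iio 0) = 0) {n : ℕ}
    (h : IsMinorant (minorantSeq A c K r₀ n) P)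
    (hθ : (minorantSeq A c K r₀ n).real univ ≤ 1 / 2)
    (hA : A ≤ mean N - (∫ k, (k : ℝ) ^ 2 ∂N) * (minorantSeq A c K r₀ n).real univ) :
    IsMinorant (minorantSeq A c K r₀ (n + 1)) (step N P) := by
  intro φ hφ _
  set r := minorantSeq A c K r₀ n with hr
  have hu : ENNReal.ofReal (1 - r.real univ) + r univ = 1 := by
    rw [← ofReal_measureReal, ← ENNReal.ofReal_add (by linarith) measureReal_nonneg]
    simp
  have hφm := hφ.measurable
  have hmax : ∀ x : ℝ, φ x ≤ φ (max x 0) := fun x => hφ.mono (le_max_left _ _)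
  calc ∫⁻ x, φ x ∂minorantSeq A c K r₀ (n + 1)
      ≤ ENNReal.ofReal A * ∫⁻ x, φ (x - 1) ∂r
        + ENNReal.ofReal c * ∫⁻ x, ∫⁻ y, φ (x + y - 1) ∂r ∂r := by
        rw [minorantSeq, ← hr]
        refine (setLIntegral_le_lintegral _ _).trans (le_of_eq ?_)
        rw [lintegral_add_measure, lintegral_smul_measure, lintegral_smul_measure,
          lintegral_map hφm (by fun_prop), lintegral_map hφm (by fun_prop),
          lintegral_prod _ (Measurable.aemeasurable (by fun_prop))]
        simp
    _ ≤ (∫⁻ ℓ, ℓ * ENNReal.ofReal (1 - r.real univ) ^ (ℓ - 1) ∂N) * ∫⁻ x, φ (max (x - 1) 0) ∂r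
      + (∫⁻ ℓ, ℓ.choose 2 * ENNReal.ofReal (1 - r.real univ) ^ (ℓ - 2) ∂N)
        * ∫⁻ x, ∫⁻ y, φ (max (x + y - 1) 0) ∂r ∂r := by
        have h1 := (ENNReal.ofReal_le_ofReal hA).trans
          (le_lintegral_mul_pow hm h2 measureReal_nonneg (by linarith))
        gcongr
        · exact hmax _
        · exact hc _ hθ
        · exact hmax _
    _ ≤ _ := h.le_lintegral_step hm hP hu hφ

/-- The recursion for the point masses of the minorant, renormalized by `m^k`. -/
lemma le_minorantSeq_singleton {A B K : ℝ} (hA : 0 ≤ A) (hB : 0 ≤ B) (r₀ : Measure ℝ)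
    [IsFiniteMeasure r₀] (n k : ℕ) (hk : K ≤ k) :
    A * (minorantSeq A B K r₀ n).real {((k + 1 : ℕ) : ℝ)} +
      B * ∑ i ∈ Finset.range (k + 2), (minorantSeq A B K r₀ n).real {(i : ℝ)} *
        (minorantSeq A B K r₀ n).real {((k + 1 - i : ℕ) : ℝ)}
      ≤ (minorantSeq A B K r₀ (n + 1)).real {(k : ℝ)} := by
  set r := minorantSeq A B K r₀ n with hr
  have h1 : r {((k + 1 : ℕ) : ℝ)} ≤ r.map (fun x => x - 1) {(k : ℝ)} := by
    rw [Measure.map_apply (by fun_prop) (measurableSet_singleton _)]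
    refine measure_mono ?_
    rintro x rfl
    simp
  have h2 : ∑ i ∈ Finset.range (k + 2), r {(i : ℝ)} * r {((k + 1 - i : ℕ) : ℝ)}
      ≤ (r.prod r).map (fun z : ℝ × ℝ => z.1 + z.2 - 1) {(k : ℝ)} := by
    rw [Measure.map_apply (by fun_prop) (measurableSet_singleton _)]
    have : ∀ i ∈ Finset.range (k + 2), r {(i : ℝ)} * r {((k + 1 - i : ℕ) : ℝ)}
        = (r.prod r) {((i : ℝ), ((k + 1 - i : ℕ) : ℝ))} := by
      intro i _
      rw [← singleton_prod_singleton, Measure.prod_prod]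
    rw [Finset.sum_congr rfl this, ← measure_biUnion_finset]
    · refine measure_mono ?_
      simp only [iUnion_subset_iff, singleton_subset_iff, Finset.mem_range]
      intro i hi
      have hi' : i ≤ k + 1 := by omega
      simp [Nat.cast_sub hi']
    · intro i _ j _ hij
      rw [Function.onFun, disjoint_singleton]
      intro h
      exact hij (Nat.cast_injective (R := ℝ) (Prod.ext_iff.1 h).1)
    · exact fun i _ => measurableSet_singleton _
  have h3 : ENNReal.ofReal A * r {((k + 1 : ℕ) : ℝ)} + ENNReal.ofReal B *
      ∑ i ∈ Finset.range (k + 2), r {(i : ℝ)} * r {((k + 1 - i : ℕ) : ℝ)}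
      ≤ minorantSeq A B K r₀ (n + 1) {(k : ℝ)} := by
    rw [minorantSeq, ← hr, Measure.restrict_apply (measurableSet_singleton _),
      inter_eq_self_of_subset_left (by simpa using hk), Measure.add_apply, Measure.smul_apply,
      Measure.smul_apply, smul_eq_mul, smul_eq_mul]
    gcongr
  have h4 := ENNReal.toReal_mono (measure_ne_top _ _) h3
  rw [ENNReal.toReal_add (ENNReal.mul_ne_top ENNReal.ofReal_ne_top (measure_ne_top _ _))
    (ENNReal.mul_ne_top ENNReal.ofReal_ne_top (ENNReal.sum_ne_top.2 fun i _ =>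
      ENNReal.mul_ne_top (measure_ne_top _ _) (measure_ne_top _ _))), ENNReal.toReal_mul,
    ENNReal.toReal_mul, ENNReal.toReal_ofReal hA, ENNReal.toReal_ofReal hB,
    ENNReal.toReal_sum fun i _ => ENNReal.mul_ne_top (measure_ne_top _ _) (measure_ne_top _ _)] at h4
  simpa [measureReal_def] using h4

/-! ### Growth of the renormalized point masses -/

section Growth

variable {a : ℕ → ℕ → ℝ} {l : ℕ} {c δ : ℝ}

lemma growth_shift (hδ1 : δ ≤ 1) (hc : 0 ≤ c) (ha : ∀ n k, 0 ≤ a n k)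
    (hrec : ∀ n k, 4 * l ≤ k → (1 - δ) * a n (k + 1) +
      c * ∑ i ∈ Finset.range (k + 2), a n i * a n (k + 1 - i) ≤ a (n + 1) k)
    (n j k : ℕ) (hk : 4 * l ≤ k) : (1 - δ) ^ j * a n (k + j) ≤ a (n + j) k := by
  induction j generalizing k with
  | zero => simp
  | succ j ih =>
    have h1 := hrec (n + j) k hk
    have h2 := ih (k + 1) (by omega)
    have h3 : 0 ≤ c * ∑ i ∈ Finset.range (k + 2), a (n + j) i * a (n + j) (k + 1 - i) :=
      mul_nonneg hc (Finset.sum_nonneg fun i _ => mul_nonneg (ha _ _) (ha _ _))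
    have h4 := mul_le_mul_of_nonneg_left h2 (sub_nonneg.2 hδ1)
    rw [pow_succ', mul_assoc, ← add_assoc n, show k + (j + 1) = k + 1 + j by ring]
    linarith

/-- If the masses are at least `A` on `[4l, 12l]`, then, after `6l` steps, mergers of pairs make
them of order `l² A²` there: one factor `l` counts the ways to split the sum, the other one counts
the times of merging. -/
lemma growth_stage (hδ0 : 0 ≤ δ) (hδ1 : δ ≤ 1) (hδ : 1 / 2 ≤ (1 - δ) ^ (6 * l)) (hc : 0 ≤ c)
    (ha : ∀ n k, 0 ≤ a n k)
    (hrec : ∀ n k, 4 * l ≤ k → (1 - δ) * a n (k + 1) +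
      c * ∑ i ∈ Finset.range (k + 2), a n i * a n (k + 1 - i) ≤ a (n + 1) k)
    {n : ℕ} {A : ℝ} (hA : 0 ≤ A) (h : ∀ k, 4 * l ≤ k → k ≤ 12 * l → A ≤ a n k)
    (k : ℕ) (hk : 4 * l ≤ k) (hk' : k ≤ 12 * l) :
    c / 16 * l ^ 2 * A ^ 2 ≤ a (n + 6 * l) k := by
  have hpow : ∀ j, j ≤ 6 * l → 1 / 2 ≤ (1 - δ) ^ j := fun j hj =>
    hδ.trans (pow_le_pow_of_le_one (by linarith) (by linarith) hj)
  have hsingle : ∀ j i, j ≤ l → 4 * l ≤ i → i ≤ 11 * l → A / 2 ≤ a (n + j) i := by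
    intro j i hj hi hi'
    refine le_trans ?_ (growth_shift hδ1 hc ha hrec n j i hi)
    have h1 := h (i + j) (by omega) (by omega)
    have h2 := hpow j (by omega)
    nlinarith
  set B : ℝ := c * (l * (A ^ 2 / 4)) with hB
  have hB0 : 0 ≤ B := by positivity
  have hpair : ∀ j s, j ≤ l → 9 * l ≤ s → s ≤ 21 * l →
      B ≤ c * ∑ i ∈ Finset.range (s + 1), a (n + j) i * a (n + j) (s - i) := by
    intro j s hj hs hs'
    refine mul_le_mul_of_nonneg_left ?_ hc
    set i₀ := max (4 * l) (s - 11 * l) with hi₀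
    calc (l : ℝ) * (A ^ 2 / 4) = ∑ _i ∈ Finset.Ico i₀ (i₀ + l), A ^ 2 / 4 := by simp
      _ ≤ ∑ i ∈ Finset.Ico i₀ (i₀ + l), a (n + j) i * a (n + j) (s - i) := by
          refine Finset.sum_le_sum fun i hi => ?_
          rw [Finset.mem_Ico] at hi
          have h1 := hsingle j i hj (by omega) (by omega)
          have h2 := hsingle j (s - i) hj (by omega) (by omega)
          nlinarith
      _ ≤ _ := by
          refine Finset.sum_le_sum_of_subset_of_nonneg (fun i hi => ?_) fun i _ _ =>
            mul_nonneg (ha _ _) (ha _ _)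
          rw [Finset.mem_Ico] at hi
          rw [Finset.mem_range]
          omega
  have hacc : ∀ j i, j ≤ l → 9 * l ≤ i → i + j ≤ 21 * l →
      (1 - δ) ^ j * (j * B) ≤ a (n + j) i := by
    intro j
    induction j with
    | zero => intro i _ _ _; simpa using ha n i
    | succ j ih =>
      intro i hj hi hi'
      have h1 := ih (i + 1) (by omega) (by omega) (by omega)
      have h2 := hpair j (i + 1) (by omega) (by omega) (by omega)
      have h3 := hrec (n + j) i (by omega)
      have h4 := mul_le_mul_of_nonneg_left h1 (sub_nonneg.2 hδ1)
      have h5 : (1 - δ) ^ (j + 1) ≤ 1 := pow_le_one₀ (by linarith) (by linarith)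
      have h6 := mul_le_mul_of_nonneg_right h5 hB0
      rw [← add_assoc n]
      rw [pow_succ'] at h6 ⊢
      push_cast
      linarith
  have h1 := hacc l (k + 5 * l) le_rfl (by omega) (by omega)
  have h2 := growth_shift hδ1 hc ha hrec (n + l) (5 * l) k hk
  rw [show n + l + 5 * l = n + 6 * l by ring] at h2
  have h3 := hpow l (by omega)
  have h4 := hpow (5 * l) (by omega)
  have h5 : 1 / 2 * (l * B) ≤ a (n + l) (k + 5 * l) := by
    refine le_trans ?_ h1
    gcongr
  have h6 : 1 / 2 * (1 / 2 * (l * B)) ≤ a (n + 6 * l) k := by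
    refine le_trans ?_ h2
    gcongr
  refine le_trans (le_of_eq ?_) h6
  rw [hB]
  ring

lemma growth_iterate (hl : 0 < l) (hδ0 : 0 ≤ δ) (hδ1 : δ ≤ 1)
    (hδ : 1 / 2 ≤ (1 - δ) ^ (6 * l)) (hc : 0 < c) (ha : ∀ n k, 0 ≤ a n k)
    (hrec : ∀ n k, 4 * l ≤ k → (1 - δ) * a n (k + 1) +
      c * ∑ i ∈ Finset.range (k + 2), a n i * a n (k + 1 - i) ≤ a (n + 1) k)
    {A : ℝ} (hA : 0 ≤ A) (h : ∀ k, 4 * l ≤ k → k ≤ 12 * l → A ≤ a 0 k)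
    (j k : ℕ) (hk : 4 * l ≤ k) (hk' : k ≤ 12 * l) :
    (c / 16 * l ^ 2 * A) ^ 2 ^ j / (c / 16 * l ^ 2) ≤ a (6 * l * j) k := by
  induction j generalizing k with
  | zero =>
    rw [pow_zero, pow_one, mul_zero, mul_div_cancel_left₀ _ (by positivity)]
    exact h k hk hk'
  | succ j ih =>
    have := growth_stage hδ0 hδ1 hδ hc.le ha hrec (by positivity) ih k hk hk'
    rw [mul_add, mul_one]
    refine le_trans (le_of_eq ?_) this
    rw [pow_succ 2 j, pow_mul]
    field_simp

end Growth

/-! ### The initial minorant -/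

/-- The two-sided bound on the tail bounds from below the mass of intervals of a fixed length. -/
lemma exists_le_Ico {ρ : Measure ℝ} [IsProbabilityMeasure ρ] {m α c₃ c₄ : ℝ} (hm : 1 < m)
    (hc₃ : 0 < c₃) (htail : ∀ᶠ x : ℝ in atTop, c₃ * x ^ α * m ^ (-x) ≤ ρ.real (Ici x) ∧
      ρ.real (Ici x) ≤ c₄ * x ^ α * m ^ (-x)) :
    ∃ (d : ℕ) (c : ℝ), 0 < d ∧ 0 < c ∧
      ∀ᶠ k : ℕ in atTop, c * (k : ℝ) ^ α / m ^ k ≤ ρ.real (Ico (k : ℝ) (k + d)) := by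
  have hm0 : 0 < m := by linarith
  have hlim : Tendsto (fun d : ℕ => |c₄| * 2 ^ |α| * (m⁻¹) ^ d) atTop (𝓝 (|c₄| * 2 ^ |α| * 0)) :=
    (tendsto_pow_atTop_nhds_zero_of_lt_one (by positivity) (inv_lt_one_of_one_lt₀ hm)).const_mul _
  rw [mul_zero] at hlim
  obtain ⟨d, hd, hd0⟩ := ((hlim.eventually_le_const (show 0 < c₃ / 2 by positivity)).and
    (eventually_gt_atTop 0)).exists
  refine ⟨d, c₃ / 2, hd0, by positivity, ?_⟩
  have h1 := tendsto_natCast_atTop_atTop (R := ℝ) |>.eventually htail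
  have h2 := (tendsto_atTop_add_const_right atTop (d : ℝ)
    (tendsto_natCast_atTop_atTop (R := ℝ))).eventually htail
  filter_upwards [h1, h2, eventually_ge_atTop d, eventually_gt_atTop 0] with k hk1 hk2 hkd hk0
  have hk0' : (0 : ℝ) < k := by exact_mod_cast hk0
  have hdiff : ρ.real (Ico (k : ℝ) (k + d)) = ρ.real (Ici (k : ℝ)) - ρ.real (Ici ((k : ℝ) + d)) := by
    rw [← measureReal_sdiff (Ici_subset_Ici.2 (by simp)) measurableSet_Ici]
    congr 1
    ext x
    simp
  have hα : ((k : ℝ) + d) ^ α ≤ 2 ^ |α| * (k : ℝ) ^ α := by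
    have hd' : (d : ℝ) ≤ k := by exact_mod_cast hkd
    have hr1 : 1 ≤ ((k : ℝ) + d) / k := by rw [le_div_iff₀ hk0']; simp
    have hr2 : ((k : ℝ) + d) / k ≤ 2 := by rw [div_le_iff₀ hk0']; linarith
    calc ((k : ℝ) + d) ^ α = (((k : ℝ) + d) / k) ^ α * (k : ℝ) ^ α := by
          rw [← Real.mul_rpow (by positivity) (by positivity)]
          field_simp
      _ ≤ (((k : ℝ) + d) / k) ^ |α| * (k : ℝ) ^ α := by
          gcongr
          exact le_abs_self α
      _ ≤ _ := by gcongr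
  have e1 : m ^ (-(k : ℝ)) = 1 / m ^ k := by
    rw [Real.rpow_neg hm0.le, Real.rpow_natCast, one_div]
  have e2 : m ^ (-((k : ℝ) + d)) = 1 / m ^ k * (m⁻¹) ^ d := by
    rw [neg_add, Real.rpow_add hm0, e1, Real.rpow_neg hm0.le, Real.rpow_natCast, inv_pow]
  have h3 : c₄ * ((k : ℝ) + d) ^ α * m ^ (-((k : ℝ) + d)) ≤ c₃ / 2 * (k : ℝ) ^ α * (1 / m ^ k) := by
    rw [e2]
    calc c₄ * ((k : ℝ) + d) ^ α * (1 / m ^ k * (m⁻¹) ^ d)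
        ≤ |c₄| * (2 ^ |α| * (k : ℝ) ^ α) * (1 / m ^ k * (m⁻¹) ^ d) := by
          gcongr
          exact le_abs_self c₄
      _ = |c₄| * 2 ^ |α| * (m⁻¹) ^ d * ((k : ℝ) ^ α * (1 / m ^ k)) := by ring
      _ ≤ c₃ / 2 * ((k : ℝ) ^ α * (1 / m ^ k)) := by gcongr
      _ = _ := by ring
  have h4 := hk1.1
  rw [e1] at h4
  rw [hdiff, div_eq_mul_one_div]
  linarith [hk2.2]

lemma sum_setLIntegral_Ico_le (ρ : Measure ℝ) (F : Finset ℕ) (d : ℕ) {φ : ℝ → ℝ≥0∞}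
    (hφ : Measurable φ) :
    ∑ k ∈ F, ∫⁻ x in Ico (k : ℝ) (k + d), φ x ∂ρ ≤ d * ∫⁻ x, φ x ∂ρ := by
  simp_rw [← lintegral_indicator (measurableSet_Ico (α := ℝ))]
  rw [← lintegral_finsetSum _ fun k _ => hφ.indicator measurableSet_Ico,
    ← lintegral_const_mul _ hφ]
  refine lintegral_mono fun x => ?_
  have hsub : ∀ k : ℕ, indicator (Ico (k : ℝ) (k + d)) φ x ≤
      if k ∈ Finset.Ico (⌊x⌋₊ + 1 - d) (⌊x⌋₊ + 1) then φ x else 0 := by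
    intro k
    by_cases hk : x ∈ Ico (k : ℝ) (k + d)
    · have h1 : k ≤ ⌊x⌋₊ := Nat.le_floor hk.1
      have h2 : ⌊x⌋₊ < k + d := by
        rw [Nat.floor_lt ((Nat.cast_nonneg k).trans hk.1)]
        exact_mod_cast hk.2
      rw [indicator_of_mem hk, if_pos (by rw [Finset.mem_Ico]; omega)]
    · rw [indicator_of_notMem hk]
      exact zero_le
  calc ∑ k ∈ F, indicator (Ico (k : ℝ) (k + d)) φ x
      ≤ ∑ k ∈ F, if k ∈ Finset.Ico (⌊x⌋₊ + 1 - d) (⌊x⌋₊ + 1) then φ x else 0 :=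
        Finset.sum_le_sum fun k _ => hsub k
    _ = (F ∩ Finset.Ico (⌊x⌋₊ + 1 - d) (⌊x⌋₊ + 1)).card * φ x := by
        rw [Finset.sum_ite_mem, Finset.sum_const, nsmul_eq_mul]
    _ ≤ d * φ x := by
        gcongr
        refine (Finset.card_le_card Finset.inter_subset_right).trans ?_
        rw [Nat.card_Ico]
        omega

/-- The measure with mass `A / m^k` at every integer `k` of `[4l, 12l]`. -/
noncomputable def initialMinorant (m A : ℝ) (l : ℕ) : Measure ℝ :=
  ∑ k ∈ Finset.Icc (4 * l) (12 * l), ENNReal.ofReal (A / m ^ k) • Measure.dirac (k : ℝ)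

instance (m A : ℝ) (l : ℕ) : IsFiniteMeasure (initialMinorant m A l) := by
  refine ⟨?_⟩
  simp only [initialMinorant, Measure.coe_finsetSum, Finset.sum_apply, Measure.smul_apply,
    measure_univ, smul_eq_mul, mul_one]
  exact ENNReal.sum_lt_top.2 fun _ _ => ENNReal.ofReal_lt_top

lemma initialMinorant_Iio (m A : ℝ) (l : ℕ) :
    initialMinorant m A l (Iio ((4 * l : ℕ) : ℝ)) = 0 := by
  simp only [initialMinorant, Measure.coe_finsetSum, Finset.sum_apply, Measure.smul_apply,
    smul_eq_mul]
  refine Finset.sum_eq_zero fun k hk => ?_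
  have : ((4 * l : ℕ) : ℝ) ≤ k := by exact_mod_cast (Finset.mem_Icc.1 hk).1
  rw [Measure.dirac_apply' _ measurableSet_Iio, indicator_of_notMem (by simpa using this), mul_zero]

lemma le_initialMinorant_singleton {m A : ℝ} (l : ℕ) {k : ℕ} (hk : 4 * l ≤ k)
    (hk' : k ≤ 12 * l) :
    A / m ^ k ≤ (initialMinorant m A l).real {(k : ℝ)} := by
  have h : ENNReal.ofReal (A / m ^ k) ≤ initialMinorant m A l {(k : ℝ)} := by
    simp only [initialMinorant, Measure.coe_finsetSum, Finset.sum_apply, Measure.smul_apply,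
      smul_eq_mul]
    refine le_trans ?_ (Finset.single_le_sum (fun _ _ => zero_le) (Finset.mem_Icc.2 ⟨hk, hk'⟩))
    simp
  exact (ENNReal.ofReal_le_iff_le_toReal (measure_ne_top _ _)).1 h

/-- Each point of the half-line is covered by at most `d` of the intervals `[k, k + d)`, so a
`d`-th of the mass of these intervals can be moved to their left end points. -/
lemma isMinorant_initialLaw {ρ : Measure ℝ} [IsProbabilityMeasure ρ] {m A p : ℝ} {d l : ℕ}
    (hd : 0 < d) (hp : 0 ≤ p)
    (h : ∀ k, 4 * l ≤ k → k ≤ 12 * l → d * (A / m ^ k) ≤ p * ρ.real (Ico (k : ℝ) (k + d))) :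
    IsMinorant (initialMinorant m A l) (initialLaw ρ p) := by
  intro φ hφ h0
  rw [lintegral_initialLaw, h0, mul_zero, zero_add, initialMinorant, lintegral_finsetSum_measure]
  have hd0 : (d : ℝ≥0∞) ≠ 0 := by exact_mod_cast hd.ne'
  rw [← ENNReal.mul_le_mul_iff_right hd0 (ENNReal.natCast_ne_top d), Finset.mul_sum]
  calc ∑ k ∈ Finset.Icc (4 * l) (12 * l),
        (d : ℝ≥0∞) * ∫⁻ x, φ x ∂(ENNReal.ofReal (A / m ^ k) • Measure.dirac (k : ℝ))
      ≤ ∑ k ∈ Finset.Icc (4 * l) (12 * l),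
        ENNReal.ofReal p * ∫⁻ x in Ico (k : ℝ) (k + d), φ x ∂ρ := by
        refine Finset.sum_le_sum fun k hk => ?_
        rw [Finset.mem_Icc] at hk
        rw [lintegral_smul_measure, lintegral_dirac, smul_eq_mul, ← mul_assoc]
        calc (d : ℝ≥0∞) * ENNReal.ofReal (A / m ^ k) * φ k
            = ENNReal.ofReal (d * (A / m ^ k)) * φ k := by
              rw [ENNReal.ofReal_mul (Nat.cast_nonneg d), ENNReal.ofReal_natCast]
          _ ≤ ENNReal.ofReal (p * ρ.real (Ico (k : ℝ) (k + d))) * φ k := by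
              exact mul_le_mul' (ENNReal.ofReal_le_ofReal (h k hk.1 hk.2)) le_rfl
          _ = ENNReal.ofReal p * (φ k * ρ (Ico (k : ℝ) (k + d))) := by
              rw [ENNReal.ofReal_mul hp, ofReal_measureReal]
              ring
          _ ≤ _ := by
              gcongr
              rw [← setLIntegral_const]
              exact setLIntegral_mono hφ.measurable fun x hx => hφ.mono hx.1
    _ = ENNReal.ofReal p * ∑ k ∈ Finset.Icc (4 * l) (12 * l),
          ∫⁻ x in Ico (k : ℝ) (k + d), φ x ∂ρ := by rw [Finset.mul_sum]
    _ ≤ ENNReal.ofReal p * (d * ∫⁻ x, φ x ∂ρ) := by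
        gcongr
        exact sum_setLIntegral_Ico_le ρ _ d hφ.measurable
    _ = _ := by ring

/-! ### The lower bound for the free energy -/

lemma rpow_le_rpow_of_mem_Icc {α : ℝ} {l k : ℕ} (hl : 0 < l) (hk : 4 * l ≤ k) (hk' : k ≤ 12 * l) :
    (12 : ℝ) ^ (-|α|) * (l : ℝ) ^ α ≤ (k : ℝ) ^ α := by
  have hl0 : (0 : ℝ) < l := by exact_mod_cast hl
  have h1 : (1 : ℝ) ≤ k / l := by
    rw [le_div_iff₀ hl0, one_mul]; exact_mod_cast (by omega : l ≤ k)
  have h2 : (k : ℝ) / l ≤ 12 := by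
    rw [div_le_iff₀ hl0]; exact_mod_cast hk'
  calc (12 : ℝ) ^ (-|α|) * (l : ℝ) ^ α ≤ ((k : ℝ) / l) ^ (-|α|) * (l : ℝ) ^ α := by
        gcongr ?_ * _
        exact Real.rpow_le_rpow_of_nonpos (by linarith) h2 (by simp)
    _ ≤ ((k : ℝ) / l) ^ α * (l : ℝ) ^ α := by
        gcongr
        exact neg_abs_le α
    _ = (k : ℝ) ^ α := by
        rw [← Real.mul_rpow (by positivity) (by positivity)]
        field_simp

/-- If `p l^(α+2)` is at least a positive power of `l`, a number of stages of growth depending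
only on this power brings the minorant to the level at which the system is supercritical. -/
theorem exists_le_freeEnergy {N : Measure ℕ} [IsProbabilityMeasure N] (hm : 1 < mean N)
    (h2 : Integrable (fun k : ℕ => (k : ℝ) ^ 2) N) {ρ : Measure ℝ} [IsProbabilityMeasure ρ]
    (hρ : ρ (Iio 0) = 0) (hρ1 : ∫⁻ x, ENNReal.ofReal x ∂ρ < ∞) {α c₃ c₄ : ℝ} (hc₃ : 0 < c₃)
    (htail : ∀ᶠ x : ℝ in atTop, c₃ * x ^ α * mean N ^ (-x) ≤ ρ.real (Ici x) ∧
      ρ.real (Ici x) ≤ c₄ * x ^ α * mean N ^ (-x)) {ε : ℝ} (hε : 0 < ε) :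
    ∃ B : ℕ, ∀ᶠ l : ℕ in atTop, ∀ p : Icc (0 : ℝ) 1, (l : ℝ) ^ ε ≤ p * (l : ℝ) ^ (α + 2) →
      1 / mean N ^ (B * l) ≤ freeEnergy N ρ p := by
  obtain ⟨R, C, hC, hescape⟩ := exists_le_freeEnergy_of_tail hm h2 hρ hρ1
  obtain ⟨c, hc, hchoose⟩ := exists_le_lintegral_choose hm
  obtain ⟨d, cb, hd, hcb, hIco⟩ := exists_le_Ico hm hc₃ htail
  set m := mean N with hmdef
  set V := ∫ k, (k : ℝ) ^ 2 ∂N with hV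
  have hm0 : 0 < m := by linarith
  have hV0 : 0 < V := hm0.trans_le (mean_le_integral_sq hm h2)
  obtain ⟨J, hJ⟩ : ∃ J : ℕ, 3 ≤ ε / 2 * 2 ^ J := by
    obtain ⟨J, hJ⟩ := pow_unbounded_of_one_lt (3 / (ε / 2)) (one_lt_two (α := ℝ))
    exact ⟨J, by rw [div_lt_iff₀ (by positivity)] at hJ; linarith⟩
  set c' := c / m with hc'
  have hc'0 : 0 < c' := by positivity
  set b : ℝ := cb / d * 12 ^ (-|α|) with hb
  have hd0 : (0 : ℝ) < d := by exact_mod_cast hd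
  have hb0 : 0 < b := by positivity
  obtain ⟨k₀, hk₀⟩ := eventually_atTop.1 hIco
  -- the mass of the minorant stays below `C / m ^ (4 l - 1)`, which is negligible
  have hlim : ∀ C' : ℝ, Tendsto (fun l : ℕ => C' * ((l : ℝ) * (1 / m ^ 4) ^ l)) atTop (𝓝 0) := by
    intro C'
    have := (tendsto_self_mul_const_pow_of_abs_lt_one (r := 1 / m ^ 4) (by
      rw [abs_of_pos (by positivity), div_lt_one (by positivity)]
      exact one_lt_pow₀ hm (by norm_num))).const_mul C'
    simpa using this
  have hlarge : ∀ᶠ l : ℕ in atTop, 1 ≤ c' / 16 * b * (l : ℝ) ^ (ε / 2) := by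
    have := ((tendsto_rpow_atTop (half_pos hε)).comp
      (tendsto_natCast_atTop_atTop (R := ℝ))).const_mul_atTop (show 0 < c' / 16 * b by positivity)
    exact this.eventually_ge_atTop 1
  have hlarge' : ∀ᶠ l : ℕ in atTop, C * m * (c' / 16) ≤ (l : ℝ) :=
    (tendsto_natCast_atTop_atTop (R := ℝ)).eventually_ge_atTop _
  refine ⟨6 * J + 12, ?_⟩
  filter_upwards [eventually_ge_atTop (R + 1), eventually_ge_atTop k₀,
    (hlim (C * m)).eventually_le_const (show (0 : ℝ) < 1 / 2 by norm_num),
    (hlim (V * C)).eventually_le_const (show (0 : ℝ) < 1 / 12 by norm_num), hlarge, hlarge']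
    with l hlR hlk hl1 hl2 hl3 hl4 p hp
  have hl : 0 < l := by omega
  have hl0 : (0 : ℝ) < l := by exact_mod_cast hl
  have hl01 : (1 : ℝ) ≤ l := by exact_mod_cast hl
  have hp0 : (0 : ℝ) ≤ p := p.2.1
  by_contra! hF
  have hsmall : ∀ n k : ℕ, n ≤ 6 * l * J → R ≤ k → k ≤ 12 * l →
      (law N ρ p n).real (Ici (k : ℝ)) < C / m ^ k := by
    intro n k hn hk hk'
    by_contra! hcon
    refine absurd (hescape p n k hk hcon) (not_le.2 (hF.trans_le ?_))
    gcongr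
    · exact hm.le
    · nlinarith
  set δ : ℝ := 1 / (12 * l) with hδ
  have hδ0 : 0 ≤ δ := by positivity
  have hδ1 : δ ≤ 1 := by rw [hδ, div_le_one (by positivity)]; linarith
  have hδp : 1 / 2 ≤ (1 - δ) ^ (6 * l) := by
    have := one_add_mul_le_pow (a := -δ) (by linarith) (6 * l)
    rw [← sub_eq_add_neg] at this
    refine le_trans (le_of_eq ?_) this
    rw [hδ]; push_cast; field_simp; norm_num
  set A : ℝ := p * b * (l : ℝ) ^ α with hA
  have hA0 : 0 ≤ A := by positivity
  set r := minorantSeq (m * (1 - δ)) c ((4 * l : ℕ) : ℝ) (initialMinorant m A l) with hr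
  have hcast : ((4 * l : ℕ) : ℝ) - 1 = ((4 * l - 1 : ℕ) : ℝ) := by
    rw [Nat.cast_sub (by omega)]; simp
  have htailr : ∀ n, n ≤ 6 * l * J → IsMinorant (r n) (law N ρ p n) →
      (r n).real (Ici ((4 * l : ℕ) : ℝ)) < C / m ^ (4 * l - 1) := by
    intro n hn hmin
    have h1 := hmin.le_Ici (a := ((4 * l : ℕ) : ℝ)) (by exact_mod_cast (by omega : 1 ≤ 4 * l))
    rw [hcast] at h1
    exact (ENNReal.toReal_mono (measure_ne_top _ _) h1).trans_lt
      (hsmall n (4 * l - 1) hn (by omega) (by omega))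
  have hCm : C / m ^ (4 * l - 1) = C * m * (1 / m ^ 4) ^ l := by
    rw [div_pow, one_pow, ← pow_mul, div_eq_iff (by positivity), mul_assoc, mul_assoc,
      ← mul_assoc m, mul_comm m, mul_assoc, ← pow_succ', show 4 * l - 1 + 1 = 4 * l by omega]
    field_simp
  have hmin : ∀ n, n ≤ 6 * l * J → IsMinorant (r n) (law N ρ p n) := by
    intro n
    induction n with
    | zero =>
      intro _
      refine isMinorant_initialLaw hd hp0 fun k hk hk' => ?_
      calc d * (A / m ^ k) = p * (cb * (12 ^ (-|α|) * (l : ℝ) ^ α) / m ^ k) := by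
            rw [hA, hb]; field_simp
        _ ≤ p * (cb * (k : ℝ) ^ α / m ^ k) := by
            gcongr
            exact rpow_le_rpow_of_mem_Icc hl hk hk'
        _ ≤ _ := by
            gcongr
            exact hk₀ k (by omega)
    | succ n ih =>
      intro hn
      have hmin := ih (by omega)
      have hθ : (r n).real univ < C / m ^ (4 * l - 1) := by
        have h0 : (r n).real (Iio ((4 * l : ℕ) : ℝ)) = 0 := by
          rw [measureReal_def, minorantSeq_Iio _ _ _ (initialMinorant_Iio m A l)]; rfl
        have h1 := measureReal_union_le (μ := r n) (Iio ((4 * l : ℕ) : ℝ)) (Ici ((4 * l : ℕ) : ℝ))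
        rw [Iio_union_Ici, h0, zero_add] at h1
        exact h1.trans_lt (htailr n (by omega) hmin)
      rw [hCm] at hθ
      have hq : 0 ≤ (1 / m ^ 4) ^ l := by positivity
      refine hmin.succ hm h2 hchoose (law_Iio_zero N hρ p n) ?_ ?_
      · refine hθ.le.trans (le_trans ?_ hl1)
        gcongr
        exact le_mul_of_one_le_left hq hl01
      · have h3 : V * (r n).real univ ≤ V * (C * m * (1 / m ^ 4) ^ l) := by gcongr
        have h4 : V * C * (1 / m ^ 4) ^ l ≤ δ := by
          rw [hδ, le_div_iff₀ (by positivity)]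
          linarith
        have h5 := mul_le_mul_of_nonneg_left h4 hm0.le
        change m * (1 - δ) ≤ m - V * (r n).real univ
        linarith
  have hgrow := growth_iterate (a := fun n k => m ^ k * (r n).real {(k : ℝ)}) (c := c') hl hδ0 hδ1
    hδp hc'0 (fun n k => by positivity) (fun n k hk => by
      have := le_minorantSeq_singleton (A := m * (1 - δ)) (B := c) (K := ((4 * l : ℕ) : ℝ))
        (mul_nonneg hm0.le (by linarith)) hc.le (initialMinorant m A l) n k (by exact_mod_cast hk)
      refine le_trans (le_of_eq ?_) (mul_le_mul_of_nonneg_left this (pow_nonneg hm0.le k))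
      rw [mul_add, ← hr, pow_succ]
      congr 1
      · ring
      · rw [hc', div_mul_eq_mul_div, div_eq_iff hm0.ne', Finset.mul_sum, Finset.mul_sum,
          Finset.mul_sum, Finset.sum_mul]
        refine Finset.sum_congr rfl fun i hi => ?_
        rw [Finset.mem_range] at hi
        have : m ^ i * m ^ (k + 1 - i) = m ^ k * m := by
          rw [← pow_add, ← pow_succ]; congr 1; omega
        calc c * (m ^ i * (r n).real {(i : ℝ)} *
              (m ^ (k + 1 - i) * (r n).real {((k + 1 - i : ℕ) : ℝ)}))
            = (m ^ i * m ^ (k + 1 - i)) * (c * ((r n).real {(i : ℝ)} *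
              (r n).real {((k + 1 - i : ℕ) : ℝ)})) := by ring
          _ = _ := by rw [this]; ring)
    hA0 (fun k hk hk' => by
      have := le_initialMinorant_singleton (m := m) (A := A) l hk hk'
      rw [div_le_iff₀' (by positivity)] at this
      exact this) J (4 * l) le_rfl (by omega)
  -- the renormalized amplitude has grown from `l ^ (ε / 2)` to `l ^ 3`
  have hlam : (l : ℝ) ^ (ε / 2) ≤ c' / 16 * l ^ 2 * A := by
    calc (l : ℝ) ^ (ε / 2) ≤ c' / 16 * b * (l : ℝ) ^ (ε / 2) * (l : ℝ) ^ (ε / 2) :=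
          le_mul_of_one_le_left (by positivity) hl3
      _ = c' / 16 * b * (l : ℝ) ^ ε := by
          rw [mul_assoc, ← Real.rpow_add hl0]; ring_nf
      _ ≤ c' / 16 * b * (p * (l : ℝ) ^ (α + 2)) := by gcongr
      _ = _ := by
          rw [hA, Real.rpow_add hl0]
          norm_cast
          ring
  have hlam3 : (l : ℝ) ^ 3 ≤ (c' / 16 * l ^ 2 * A) ^ 2 ^ J := by
    calc (l : ℝ) ^ 3 = (l : ℝ) ^ (3 : ℝ) := by norm_cast
      _ ≤ (l : ℝ) ^ (ε / 2 * 2 ^ J) := Real.rpow_le_rpow_of_exponent_le hl01 hJ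
      _ = ((l : ℝ) ^ (ε / 2)) ^ 2 ^ J := by
          rw [Real.rpow_mul hl0.le]
          exact_mod_cast Real.rpow_natCast _ (2 ^ J)
      _ ≤ _ := by gcongr
  have hfinal : C * m ≤ m ^ (4 * l) * (r (6 * l * J)).real {((4 * l : ℕ) : ℝ)} := by
    refine le_trans ?_ hgrow
    rw [le_div_iff₀ (by positivity)]
    calc C * m * (c' / 16 * (l : ℝ) ^ 2) = C * m * (c' / 16) * (l : ℝ) ^ 2 := by ring
      _ ≤ l * (l : ℝ) ^ 2 := by gcongr
      _ = (l : ℝ) ^ 3 := by ring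
      _ ≤ _ := hlam3
  have hlt := htailr _ le_rfl (hmin _ le_rfl)
  have hle : (r (6 * l * J)).real {((4 * l : ℕ) : ℝ)}
      ≤ (r (6 * l * J)).real (Ici ((4 * l : ℕ) : ℝ)) :=
    measureReal_mono (by simp)
  have hlt' := mul_lt_mul_of_pos_left (hle.trans_lt hlt) (show 0 < m ^ (4 * l) by positivity)
  have hCm' : m ^ (4 * l) * (C / m ^ (4 * l - 1)) = C * m := by
    rw [mul_div_assoc', div_eq_iff (by positivity), mul_assoc C, ← pow_succ',
      show 4 * l - 1 + 1 = 4 * l by omega, mul_comm]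
  linarith

/-! ### Moments of the initial law -/

/-- The tail bound, in a form that holds for every integer. -/
lemma exists_real_Ici_le {ρ : Measure ℝ} [IsProbabilityMeasure ρ] {m α c₃ c₄ : ℝ} (hm : 1 < m)
    (htail : ∀ᶠ x : ℝ in atTop, c₃ * x ^ α * m ^ (-x) ≤ ρ.real (Ici x) ∧
      ρ.real (Ici x) ≤ c₄ * x ^ α * m ^ (-x)) :
    ∃ C : ℝ, 0 < C ∧ ∀ k : ℕ, ρ.real (Ici (k : ℝ)) ≤ C * ((k : ℝ) + 1) ^ α / m ^ k := by
  have hm0 : 0 < m := by linarith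
  have hb : IsBoundedUnder (· ≤ ·) atTop
      (fun k : ℕ => ρ.real (Ici (k : ℝ)) / (((k : ℝ) + 1) ^ α / m ^ k)) := by
    refine ⟨|c₄| * 2 ^ |α|, ?_⟩
    rw [eventually_map]
    filter_upwards [(tendsto_natCast_atTop_atTop (R := ℝ)).eventually htail,
      eventually_gt_atTop 0] with k hk hk0
    have hk0' : (0 : ℝ) < k := by exact_mod_cast hk0
    have hk1 : (1 : ℝ) ≤ k := by exact_mod_cast hk0
    rw [div_le_iff₀ (by positivity)]
    refine hk.2.trans ?_
    have e1 : m ^ (-(k : ℝ)) = 1 / m ^ k := by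
      rw [Real.rpow_neg hm0.le, Real.rpow_natCast, one_div]
    have hα : (k : ℝ) ^ α ≤ 2 ^ |α| * ((k : ℝ) + 1) ^ α := by
      have hr1 : 1 ≤ ((k : ℝ) + 1) / k := by rw [le_div_iff₀ hk0']; simp
      have hr2 : ((k : ℝ) + 1) / k ≤ 2 := by rw [div_le_iff₀ hk0']; linarith
      calc (k : ℝ) ^ α = (((k : ℝ) + 1) / k) ^ (-α) * ((k : ℝ) + 1) ^ α := by
            rw [Real.rpow_neg (by positivity), Real.div_rpow (by positivity) (by positivity)]
            field_simp
        _ ≤ (((k : ℝ) + 1) / k) ^ |α| * ((k : ℝ) + 1) ^ α := by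
            gcongr
            exact neg_le_abs α
        _ ≤ _ := by gcongr
    rw [e1]
    calc c₄ * (k : ℝ) ^ α * (1 / m ^ k) ≤ |c₄| * (2 ^ |α| * ((k : ℝ) + 1) ^ α) * (1 / m ^ k) := by
          gcongr
          exact le_abs_self c₄
      _ = _ := by ring
  obtain ⟨C, hC⟩ := hb.bddAbove_range
  refine ⟨max C 1, by positivity, fun k => ?_⟩
  have h := hC ⟨k, rfl⟩
  simp only at h
  rw [div_le_iff₀ (by positivity)] at h
  refine h.trans ?_
  rw [mul_div_assoc]
  gcongr
  exact le_max_left _ _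

lemma lintegral_le_tsum {ρ : Measure ℝ} (hρ : ρ (Iio 0) = 0) {φ : ℝ → ℝ≥0∞} {b : ℕ → ℝ≥0∞}
    (h : ∀ (k : ℕ) (y : ℝ), (k : ℝ) ≤ y → y < k + 1 → φ y ≤ b k) :
    ∫⁻ y, φ y ∂ρ ≤ ∑' k : ℕ, b k * ρ (Ici (k : ℝ)) := by
  calc ∫⁻ y, φ y ∂ρ ≤ ∫⁻ y, ∑' k : ℕ, indicator (Ici (k : ℝ)) (fun _ => b k) y ∂ρ := by
        refine lintegral_mono_ae ?_
        filter_upwards [ae_nonneg hρ] with y hy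
        refine le_trans ?_ (ENNReal.le_tsum ⌊y⌋₊)
        rw [indicator_of_mem (show y ∈ Ici ((⌊y⌋₊ : ℕ) : ℝ) from Nat.floor_le hy)]
        exact h _ _ (Nat.floor_le hy) (Nat.lt_floor_add_one y)
    _ = ∑' k : ℕ, b k * ρ (Ici (k : ℝ)) := by
        rw [lintegral_tsum fun k => (measurable_const.indicator measurableSet_Ici).aemeasurable]
        simp [lintegral_indicator measurableSet_Ici]

lemma lintegral_mul_rpow_lt_top {ρ : Measure ℝ} [IsProbabilityMeasure ρ] {m α C : ℝ} (hm : 1 < m)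
    (hρ : ρ (Iio 0) = 0)
    (hC : ∀ k : ℕ, ρ.real (Ici (k : ℝ)) ≤ C * ((k : ℝ) + 1) ^ α / m ^ k) :
    ∫⁻ y, ENNReal.ofReal (y * m ^ (y / 2)) ∂ρ < ∞ := by
  have hm0 : 0 < m := by linarith
  set q : ℝ := m ^ (-(1 / 2) : ℝ) with hq
  have hq0 : 0 < q := by positivity
  have hq1 : q < 1 := Real.rpow_lt_one_of_one_lt_of_neg hm (by norm_num)
  obtain ⟨M, hM⟩ := exists_nat_ge (α + 1)
  have hsum : Summable fun k : ℕ => |C| * m * (((k + 1 : ℕ) : ℝ) ^ M * q ^ (k + 1)) := by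
    refine Summable.mul_left _ ?_
    exact (summable_nat_add_iff 1).2
      (summable_pow_mul_geometric_of_norm_lt_one (R := ℝ) M (by rwa [Real.norm_of_nonneg hq0.le]))
  refine (lintegral_le_tsum hρ (b := fun k =>
    ENNReal.ofReal (((k : ℝ) + 1) * m ^ (((k : ℝ) + 1) / 2))) fun k y hk hy => ?_).trans_lt ?_
  · have : (0 : ℝ) ≤ y := (Nat.cast_nonneg k).trans hk
    refine ENNReal.ofReal_le_ofReal ?_
    gcongr
    exact hm.le
  · refine lt_of_le_of_lt (ENNReal.tsum_le_tsum fun k => ?_) hsum.tsum_ofReal_lt_top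
    rw [← ofReal_measureReal, ← ENNReal.ofReal_mul (by positivity)]
    refine ENNReal.ofReal_le_ofReal ?_
    have e1 : m ^ (((k : ℝ) + 1) / 2) = m ^ (k + 1) * q ^ (k + 1) := by
      rw [hq, ← Real.rpow_natCast, ← Real.rpow_natCast, ← Real.rpow_mul hm0.le,
        ← Real.rpow_add hm0]
      push_cast
      ring_nf
    have e2 : ((k : ℝ) + 1) * ((k : ℝ) + 1) ^ α ≤ ((k : ℝ) + 1) ^ M := by
      have hk1 : (1 : ℝ) ≤ (k : ℝ) + 1 := by linarith [Nat.cast_nonneg (α := ℝ) k]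
      calc ((k : ℝ) + 1) * ((k : ℝ) + 1) ^ α = ((k : ℝ) + 1) ^ (α + 1) := by
            rw [Real.rpow_add (by linarith), Real.rpow_one, mul_comm]
        _ ≤ ((k : ℝ) + 1) ^ (M : ℝ) := Real.rpow_le_rpow_of_exponent_le hk1 hM
        _ = _ := Real.rpow_natCast _ _
    calc ((k : ℝ) + 1) * m ^ (((k : ℝ) + 1) / 2) * ρ.real (Ici (k : ℝ))
        ≤ ((k : ℝ) + 1) * m ^ (((k : ℝ) + 1) / 2) * (|C| * ((k : ℝ) + 1) ^ α / m ^ k) := by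
          gcongr
          refine (hC k).trans ?_
          gcongr
          exact le_abs_self C
      _ = |C| * m * (((k : ℝ) + 1) * ((k : ℝ) + 1) ^ α * q ^ (k + 1)) := by
          rw [e1, pow_succ m]; field_simp
      _ ≤ _ := by
          push_cast
          gcongr

lemma lintegral_ofReal_lt_top {ρ : Measure ℝ} {m : ℝ} (hm : 1 < m) (hρ : ρ (Iio 0) = 0)
    (h : ∫⁻ y, ENNReal.ofReal (y * m ^ (y / 2)) ∂ρ < ∞) : ∫⁻ y, ENNReal.ofReal y ∂ρ < ∞ := by
  refine lt_of_le_of_lt (lintegral_mono_ae ?_) h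
  filter_upwards [ae_nonneg hρ] with y hy
  exact ENNReal.ofReal_le_ofReal
    (le_mul_of_one_le_right hy (Real.one_le_rpow hm.le (by positivity)))

lemma sum_rpow_le {γ : ℝ} (hγ : -1 < γ) :
    ∃ C : ℝ, 0 < C ∧ ∀ n : ℕ, ∑ k ∈ Finset.range n, ((k : ℝ) + 1) ^ γ ≤ C * (n : ℝ) ^ (γ + 1) := by
  rcases le_or_gt 0 γ with h | h
  · refine ⟨1, one_pos, fun n => ?_⟩
    rcases Nat.eq_zero_or_pos n with rfl | hn
    · simp [Real.zero_rpow (by linarith : γ + 1 ≠ 0)]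
    have hn0 : (0 : ℝ) < n := by exact_mod_cast hn
    calc ∑ k ∈ Finset.range n, ((k : ℝ) + 1) ^ γ ≤ ∑ _k ∈ Finset.range n, (n : ℝ) ^ γ := by
          refine Finset.sum_le_sum fun k hk => ?_
          have : (k : ℝ) + 1 ≤ n := by exact_mod_cast Finset.mem_range.1 hk
          gcongr
      _ = _ := by
          rw [Finset.sum_const, Finset.card_range, nsmul_eq_mul, Real.rpow_add hn0, Real.rpow_one]
          ring
  · -- the summand is at most the increment of `x ^ (γ + 1) / (γ + 1)`, by Bernoulli's inequality
    have hs : 0 < γ + 1 := by linarith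
    refine ⟨1 / (γ + 1), by positivity, fun n => ?_⟩
    rw [one_div_mul_eq_div, le_div_iff₀ hs]
    induction n with
    | zero => simp [Real.zero_rpow hs.ne']
    | succ n ih =>
      rw [Finset.sum_range_succ, add_mul]
      have hn : (0 : ℝ) < (n : ℝ) + 1 := by positivity
      have hB := rpow_one_add_le_one_add_mul_self (s := -1 / ((n : ℝ) + 1)) (p := γ + 1)
        (by rw [le_div_iff₀ hn]; linarith [Nat.cast_nonneg (α := ℝ) n]) hs.le (by linarith)
      have e : 1 + -1 / ((n : ℝ) + 1) = n / (n + 1) := by field_simp; ring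
      rw [e, Real.div_rpow (by positivity) hn.le, div_le_iff₀ (by positivity)] at hB
      have e2 : ((n : ℝ) + 1) ^ (γ + 1) = ((n : ℝ) + 1) ^ γ * (n + 1) := by
        rw [Real.rpow_add hn, Real.rpow_one]
      have e3 : (1 + (γ + 1) * (-1 / ((n : ℝ) + 1))) * ((n : ℝ) + 1) ^ (γ + 1)
          = ((n : ℝ) + 1) ^ (γ + 1) - (γ + 1) * ((n : ℝ) + 1) ^ γ := by
        rw [e2]; field_simp; ring
      rw [e3] at hB
      push_cast
      linarith

/-! ### A Lyapunov functional for the truncated system -/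

/-- The weight `m^x` of positive values. -/
noncomputable def expWeight (m : ℝ) : ℝ → ℝ≥0∞ :=
  indicator (Ioi 0) fun x => ENNReal.ofReal (m ^ x)

/-- The weight `m^x (x + j + 1)^β` of positive values at time `j`. One step of the recursion moves
`x` to `x - 1` and `j` to `j + 1`, which changes the weight by the factor `m⁻¹` only. -/
noncomputable def lyapunovWeight (m β : ℝ) (j : ℕ) : ℝ → ℝ≥0∞ :=
  indicator (Ioi 0) fun x => ENNReal.ofReal (m ^ x * (x + j + 1) ^ β)

lemma measurable_expWeight (m : ℝ) : Measurable (expWeight m) :=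
  Measurable.indicator (by fun_prop) measurableSet_Ioi

lemma measurable_lyapunovWeight (m β : ℝ) (j : ℕ) : Measurable (lyapunovWeight m β j) :=
  Measurable.indicator (by fun_prop) measurableSet_Ioi

lemma one_add_expWeight_add_le {m : ℝ} (hm : 0 < m) {y s : ℝ} (hy : 0 ≤ y) (hs : 0 ≤ s) :
    1 + expWeight m (y + s) ≤ (1 + expWeight m y) * (1 + expWeight m s) := by
  rcases hy.eq_or_lt with rfl | hy'
  · simp [expWeight]
  rcases hs.eq_or_lt with rfl | hs'
  · simp [expWeight]
  have e : expWeight m (y + s) = expWeight m y * expWeight m s := by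
    simp only [expWeight, indicator, mem_Ioi, hy', hs', add_pos hy' hs', if_true]
    rw [Real.rpow_add hm, ENNReal.ofReal_mul (by positivity)]
  calc 1 + expWeight m (y + s) ≤ 1 + expWeight m (y + s) + (expWeight m y + expWeight m s) :=
        le_self_add
    _ = _ := by rw [e]; ring

/-- Subadditivity of `x ↦ x^β` distributes the weight of a sum over its terms. -/
lemma lyapunovWeight_add_le {m β : ℝ} (hm : 0 < m) (hβ0 : 0 ≤ β) (hβ1 : β ≤ 1) (j : ℕ) {y s : ℝ}
    (hy : 0 ≤ y) (hs : 0 ≤ s) :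
    lyapunovWeight m β j (y + s) ≤ lyapunovWeight m β j y * (1 + expWeight m s)
      + (1 + expWeight m y) * lyapunovWeight m β j s := by
  rcases hy.eq_or_lt with rfl | hy'
  · simp [lyapunovWeight, expWeight]
  rcases hs.eq_or_lt with rfl | hs'
  · simp [lyapunovWeight, expWeight]
  simp only [lyapunovWeight, expWeight, indicator, mem_Ioi, hy', hs', add_pos hy' hs', if_true]
  have hsub : (y + s + j + 1) ^ β ≤ (y + j + 1) ^ β + (s + j + 1) ^ β := by
    have h1 : y + s + j + 1 ≤ (y + j + 1) + (s + j + 1) := by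
      linarith [Nat.cast_nonneg (α := ℝ) j]
    exact (Real.rpow_le_rpow (by positivity) h1 hβ0).trans
      (Real.rpow_add_le_add_rpow (by positivity) (by positivity) hβ0 hβ1)
  calc ENNReal.ofReal (m ^ (y + s) * (y + s + j + 1) ^ β)
      ≤ ENNReal.ofReal (m ^ y * (y + j + 1) ^ β * m ^ s + m ^ y * (m ^ s * (s + j + 1) ^ β)) := by
        refine ENNReal.ofReal_le_ofReal ?_
        rw [Real.rpow_add hm]
        have := mul_le_mul_of_nonneg_left hsub (show 0 ≤ m ^ y * m ^ s by positivity)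
        linarith
    _ = ENNReal.ofReal (m ^ y * (y + j + 1) ^ β) * ENNReal.ofReal (m ^ s)
        + ENNReal.ofReal (m ^ y) * ENNReal.ofReal (m ^ s * (s + j + 1) ^ β) := by
        rw [ENNReal.ofReal_add (by positivity) (by positivity),
          ENNReal.ofReal_mul (p := m ^ y * (y + j + 1) ^ β) (by positivity),
          ENNReal.ofReal_mul (p := m ^ y) (q := m ^ s * (s + j + 1) ^ β) (by positivity)]
    _ ≤ _ := by
        gcongr
        · exact le_add_self
        · exact le_add_self

lemma lintegral_one_add_expWeight_sumLaw_le {m : ℝ} (hm : 0 < m) {P : Measure ℝ}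
    [IsProbabilityMeasure P] (hP : P (Iio 0) = 0) (ℓ : ℕ) :
    ∫⁻ s, (1 + expWeight m s) ∂sumLaw P ℓ ≤ (1 + ∫⁻ x, expWeight m x ∂P) ^ ℓ := by
  have hu := measurable_expWeight m
  induction ℓ with
  | zero =>
    rw [lintegral_sumLaw_zero P (by fun_prop)]
    simp [expWeight]
  | succ ℓ ih =>
    rw [lintegral_sumLaw_succ P ℓ (by fun_prop)]
    calc ∫⁻ y, ∫⁻ s, (1 + expWeight m (y + s)) ∂sumLaw P ℓ ∂P
        ≤ ∫⁻ y, ∫⁻ s, (1 + expWeight m y) * (1 + expWeight m s) ∂sumLaw P ℓ ∂P := by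
          refine lintegral_mono_ae ?_
          filter_upwards [ae_nonneg hP] with y hy
          refine lintegral_mono_ae ?_
          filter_upwards [ae_nonneg (sumLaw_Iio_zero hP ℓ)] with s hs
          exact one_add_expWeight_add_le hm hy hs
      _ = (1 + ∫⁻ x, expWeight m x ∂P) * ∫⁻ s, (1 + expWeight m s) ∂sumLaw P ℓ := by
          simp_rw [lintegral_const_mul _ (show Measurable fun s => 1 + expWeight m s by fun_prop)]
          rw [lintegral_mul_const _ (by fun_prop), lintegral_add_left measurable_const]
          simp
      _ ≤ _ := by rw [pow_succ']; gcongr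

lemma lintegral_lyapunovWeight_sumLaw_le {m β : ℝ} (hm : 0 < m) (hβ0 : 0 ≤ β) (hβ1 : β ≤ 1)
    (j : ℕ) {P : Measure ℝ} [IsProbabilityMeasure P] (hP : P (Iio 0) = 0) (ℓ : ℕ) :
    ∫⁻ s, lyapunovWeight m β j s ∂sumLaw P ℓ ≤
      ℓ * (1 + ∫⁻ x, expWeight m x ∂P) ^ (ℓ - 1) * ∫⁻ x, lyapunovWeight m β j x ∂P := by
  have hu := measurable_expWeight m
  have hw := measurable_lyapunovWeight m β j
  set U := 1 + ∫⁻ x, expWeight m x ∂P with hU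
  have hU' : ∫⁻ x, (1 + expWeight m x) ∂P = U := by
    rw [lintegral_add_left measurable_const]; simp [hU]
  induction ℓ with
  | zero =>
    rw [lintegral_sumLaw_zero P hw]
    simp [lyapunovWeight]
  | succ ℓ ih =>
    rw [lintegral_sumLaw_succ P ℓ hw]
    calc ∫⁻ y, ∫⁻ s, lyapunovWeight m β j (y + s) ∂sumLaw P ℓ ∂P
        ≤ ∫⁻ y, ∫⁻ s, (lyapunovWeight m β j y * (1 + expWeight m s)
          + (1 + expWeight m y) * lyapunovWeight m β j s) ∂sumLaw P ℓ ∂P := by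
          refine lintegral_mono_ae ?_
          filter_upwards [ae_nonneg hP] with y hy
          refine lintegral_mono_ae ?_
          filter_upwards [ae_nonneg (sumLaw_Iio_zero hP ℓ)] with s hs
          exact lyapunovWeight_add_le hm hβ0 hβ1 j hy hs
      _ = (∫⁻ x, lyapunovWeight m β j x ∂P) * ∫⁻ s, (1 + expWeight m s) ∂sumLaw P ℓ
          + U * ∫⁻ s, lyapunovWeight m β j s ∂sumLaw P ℓ := by
          have e : ∀ y, ∫⁻ s, (lyapunovWeight m β j y * (1 + expWeight m s)
              + (1 + expWeight m y) * lyapunovWeight m β j s) ∂sumLaw P ℓ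
              = lyapunovWeight m β j y * ∫⁻ s, (1 + expWeight m s) ∂sumLaw P ℓ
              + (1 + expWeight m y) * ∫⁻ s, lyapunovWeight m β j s ∂sumLaw P ℓ := by
            intro y
            rw [lintegral_add_left (by fun_prop), lintegral_const_mul _ (by fun_prop),
              lintegral_const_mul _ hw]
          simp_rw [e]
          rw [lintegral_add_left (by fun_prop), lintegral_mul_const _ hw,
            lintegral_mul_const _ (by fun_prop), hU']
      _ ≤ (∫⁻ x, lyapunovWeight m β j x ∂P) * U ^ ℓ
          + U * (ℓ * U ^ (ℓ - 1) * ∫⁻ x, lyapunovWeight m β j x ∂P) := by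
          gcongr
          exact lintegral_one_add_expWeight_sumLaw_le hm hP ℓ
      _ = _ := by
          have e1 : U * (ℓ * U ^ (ℓ - 1)) = ℓ * U ^ ℓ := by
            cases ℓ with
            | zero => simp
            | succ n => simp only [Nat.add_sub_cancel, pow_succ]; ring
          rw [← mul_assoc U, e1, Nat.add_sub_cancel]
          push_cast
          ring

/-- `E(ν (1 + x)^(ν-1)) ≤ m (1 + D x)` for small `x`, since `ν` has an exponential moment. -/
lemma exists_lintegral_mul_pow_le {N : Measure ℕ} (hm : 1 < mean N)
    (hexp : ∃ t : ℝ, 1 < t ∧ Integrable (fun k : ℕ => t ^ k) N) :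
    ∃ D u₀ : ℝ, 0 < D ∧ 0 < u₀ ∧ ∀ x : ℝ, 0 ≤ x → x ≤ u₀ →
      ∫⁻ k, k * (1 + ENNReal.ofReal x) ^ (k - 1) ∂N ≤ ENNReal.ofReal (mean N * (1 + D * x)) := by
  obtain ⟨t, ht1, ht⟩ := hexp
  set u₀ := (t - 1) / 2 with hu₀
  have hu₀0 : 0 < u₀ := by rw [hu₀]; linarith
  have hW := integrable_sq_mul_pow ht (s := 1 + u₀) (by linarith) (by rw [hu₀]; linarith)
  have hi := integrable_natCast hm
  set W := ∫ k, (k : ℝ) ^ 2 * (1 + u₀) ^ k ∂N with hWdef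
  have hW0 : 0 ≤ W := integral_nonneg fun k => by positivity
  have hm0 : 0 < mean N := by linarith
  refine ⟨W / mean N + 1, u₀, by positivity, hu₀0, fun x hx0 hx => ?_⟩
  have hpt : ∀ k : ℕ, (k : ℝ) * (1 + x) ^ (k - 1) ≤ k + x * (k ^ 2 * (1 + u₀) ^ k) := by
    intro k
    have h1 : ∀ n : ℕ, (1 + x) ^ n ≤ 1 + n * x * (1 + u₀) ^ n := by
      intro n
      induction n with
      | zero => simp
      | succ n ih =>
        have h2 : (1 + x) ^ n ≤ (1 + u₀) ^ n := by gcongr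
        have h3 : (1 + u₀) ^ n ≤ (1 + u₀) ^ (n + 1) :=
          pow_le_pow_right₀ (by linarith) (by omega)
        calc (1 + x) ^ (n + 1) = (1 + x) ^ n + x * (1 + x) ^ n := by ring
          _ ≤ 1 + n * x * (1 + u₀) ^ n + x * (1 + u₀) ^ n := by gcongr
          _ = 1 + (n + 1) * x * (1 + u₀) ^ n := by ring
          _ ≤ 1 + (n + 1) * x * (1 + u₀) ^ (n + 1) := by gcongr
          _ = _ := by push_cast; ring
    rcases k with _ | k
    · simp
    · simp only [Nat.add_sub_cancel]
      have h3 : (1 + u₀) ^ k ≤ (1 + u₀) ^ (k + 1) :=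
          pow_le_pow_right₀ (by linarith) (by omega)
      have h4 : (k : ℝ) ≤ (k + 1 : ℕ) := by push_cast; linarith
      calc ((k + 1 : ℕ) : ℝ) * (1 + x) ^ k
          ≤ ((k + 1 : ℕ) : ℝ) * (1 + ((k + 1 : ℕ) : ℝ) * x * (1 + u₀) ^ (k + 1)) := by
            gcongr
            exact (h1 k).trans (by gcongr)
        _ = _ := by ring
  have hbound : Integrable (fun k : ℕ => (k : ℝ) + x * ((k : ℝ) ^ 2 * (1 + u₀) ^ k)) N :=
    hi.add (hW.const_mul x)
  calc ∫⁻ k, k * (1 + ENNReal.ofReal x) ^ (k - 1) ∂N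
      ≤ ∫⁻ k, ENNReal.ofReal ((k : ℝ) + x * ((k : ℝ) ^ 2 * (1 + u₀) ^ k)) ∂N := by
        refine lintegral_mono fun k => ?_
        refine le_trans (le_of_eq ?_) (ENNReal.ofReal_le_ofReal (hpt k))
        rw [ENNReal.ofReal_mul (by positivity), ENNReal.ofReal_pow (by positivity),
          ENNReal.ofReal_add zero_le_one hx0]
        simp
    _ = ENNReal.ofReal (mean N + x * W) := by
        rw [← ofReal_integral_eq_lintegral_ofReal hbound (ae_of_all _ fun k => by positivity),
          integral_add hi (hW.const_mul x), integral_const_mul]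
        rfl
    _ ≤ _ := by
        refine ENNReal.ofReal_le_ofReal ?_
        have : mean N * (1 + (W / mean N + 1) * x) = mean N + x * W + mean N * x := by
          field_simp; ring
        rw [this]
        linarith [mul_nonneg hm0.le hx0]

lemma lyapunovWeight_step_le {m β : ℝ} (hm : 0 < m) (j : ℕ) (s : ℝ) :
    lyapunovWeight m β (j + 1) (max (s - 1) 0) ≤
      ENNReal.ofReal m⁻¹ * lyapunovWeight m β j s := by
  rcases le_or_gt s 1 with h | h
  · rw [max_eq_right (by linarith)]
    simp [lyapunovWeight]
  · have hs : 0 < s := by linarith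
    rw [max_eq_left (by linarith)]
    simp only [lyapunovWeight, indicator, mem_Ioi, hs, sub_pos.2 h, if_true]
    rw [← ENNReal.ofReal_mul (by positivity), Real.rpow_sub hm, Real.rpow_one]
    refine ENNReal.ofReal_le_ofReal (le_of_eq ?_)
    push_cast
    rw [show s - 1 + ((j : ℝ) + 1) + 1 = s + j + 1 by ring]
    field_simp

/-- One step multiplies the functional by at most `1 + D (j+1)^(-β)` times itself. -/
lemma lintegral_lyapunovWeight_step_le {N : Measure ℕ} (hm : 1 < mean N) {D u₀ : ℝ} (hD : 0 < D)
    (hDu : ∀ x : ℝ, 0 ≤ x → x ≤ u₀ →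
      ∫⁻ k, k * (1 + ENNReal.ofReal x) ^ (k - 1) ∂N ≤ ENNReal.ofReal (mean N * (1 + D * x)))
    {β : ℝ} (hβ0 : 0 ≤ β) (hβ1 : β ≤ 1) (j : ℕ) {P : Measure ℝ} [IsProbabilityMeasure P]
    (hP : P (Iio 0) = 0) {y : ℝ} (hy0 : 0 ≤ y) (hyu : y ≤ u₀)
    (hy : ∫⁻ x, lyapunovWeight (mean N) β j x ∂P ≤ ENNReal.ofReal y) :
    ∫⁻ x, lyapunovWeight (mean N) β (j + 1) x ∂step N P ≤
      ENNReal.ofReal (y * (1 + D * (((j : ℝ) + 1) ^ (-β) * y))) := by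
  set m := mean N with hmdef
  have hm0 : 0 < m := by linarith
  set x : ℝ := ((j : ℝ) + 1) ^ (-β) * y with hx
  have hx0 : 0 ≤ x := by positivity
  have hxu : x ≤ u₀ := by
    refine le_trans ?_ hyu
    exact mul_le_of_le_one_left hy0 (Real.rpow_le_one_of_one_le_of_nonpos
      (by linarith [Nat.cast_nonneg (α := ℝ) j]) (by linarith))
  have hU : ∫⁻ z, expWeight m z ∂P ≤ ENNReal.ofReal x := by
    calc ∫⁻ z, expWeight m z ∂P
        ≤ ∫⁻ z, ENNReal.ofReal (((j : ℝ) + 1) ^ (-β)) * lyapunovWeight m β j z ∂P := by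
          refine lintegral_mono fun z => ?_
          rcases le_or_gt z 0 with h | h
          · simp [expWeight, not_lt.2 h]
          · simp only [expWeight, lyapunovWeight, indicator, mem_Ioi, h, if_true]
            rw [← ENNReal.ofReal_mul (by positivity)]
            refine ENNReal.ofReal_le_ofReal ?_
            have h1 : ((j : ℝ) + 1) ^ β ≤ (z + j + 1) ^ β := by
              gcongr ?_ ^ β
              linarith
            calc m ^ z = ((j : ℝ) + 1) ^ (-β) * (m ^ z * ((j : ℝ) + 1) ^ β) := by
                  rw [Real.rpow_neg (by positivity)]; field_simp
              _ ≤ _ := by gcongr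
      _ = ENNReal.ofReal (((j : ℝ) + 1) ^ (-β)) * ∫⁻ z, lyapunovWeight m β j z ∂P :=
          lintegral_const_mul _ (measurable_lyapunovWeight m β j)
      _ ≤ _ := by
          rw [hx, ENNReal.ofReal_mul (by positivity)]
          gcongr
  rw [lintegral_step N P (measurable_lyapunovWeight m β (j + 1))]
  calc ∫⁻ k, ∫⁻ s, lyapunovWeight m β (j + 1) (max (s - 1) 0) ∂sumLaw P k ∂N
      ≤ ∫⁻ k, (k * (1 + ENNReal.ofReal x) ^ (k - 1)) *
          (ENNReal.ofReal m⁻¹ * ENNReal.ofReal y) ∂N := by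
        refine lintegral_mono fun k => ?_
        calc ∫⁻ s, lyapunovWeight m β (j + 1) (max (s - 1) 0) ∂sumLaw P k
            ≤ ∫⁻ s, ENNReal.ofReal m⁻¹ * lyapunovWeight m β j s ∂sumLaw P k :=
              lintegral_mono fun s => lyapunovWeight_step_le hm0 j s
          _ = ENNReal.ofReal m⁻¹ * ∫⁻ s, lyapunovWeight m β j s ∂sumLaw P k :=
              lintegral_const_mul _ (measurable_lyapunovWeight m β j)
          _ ≤ ENNReal.ofReal m⁻¹ * (k * (1 + ENNReal.ofReal x) ^ (k - 1) * ENNReal.ofReal y) := by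
              gcongr
              refine (lintegral_lyapunovWeight_sumLaw_le hm0 hβ0 hβ1 j hP k).trans ?_
              gcongr
          _ = _ := by ring
    _ = (∫⁻ k, k * (1 + ENNReal.ofReal x) ^ (k - 1) ∂N) *
          (ENNReal.ofReal m⁻¹ * ENNReal.ofReal y) :=
        lintegral_mul_const _ Measurable.of_discrete
    _ ≤ ENNReal.ofReal (m * (1 + D * x)) * (ENNReal.ofReal m⁻¹ * ENNReal.ofReal y) := by
        gcongr
        exact hDu x hx0 hxu
    _ = _ := by
        rw [← ENNReal.ofReal_mul (by positivity), ← ENNReal.ofReal_mul (by positivity)]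
        congr 1
        field_simp

/-- As long as the sum of the coefficients `(i+1)^(-β)` is small compared to the inverse of the
initial value, the functional at most doubles. -/
lemma lintegral_lyapunovWeight_law_le {N : Measure ℕ} [IsProbabilityMeasure N] (hm : 1 < mean N)
    {D u₀ : ℝ} (hD : 0 < D)
    (hDu : ∀ x : ℝ, 0 ≤ x → x ≤ u₀ →
      ∫⁻ k, k * (1 + ENNReal.ofReal x) ^ (k - 1) ∂N ≤ ENNReal.ofReal (mean N * (1 + D * x)))
    {β : ℝ} (hβ0 : 0 ≤ β) (hβ1 : β ≤ 1) {ρ : Measure ℝ} [IsProbabilityMeasure ρ]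
    (hρ : ρ (Iio 0) = 0) (p : Icc (0 : ℝ) 1) {y : ℝ} (hy0 : 0 ≤ y) (hyu : 2 * y ≤ u₀)
    (hy : ∫⁻ x, lyapunovWeight (mean N) β 0 x ∂initialLaw ρ p ≤ ENNReal.ofReal y) {n : ℕ}
    (hn : 4 * D * y * ∑ i ∈ Finset.range n, ((i : ℝ) + 1) ^ (-β) ≤ 1) :
    ∫⁻ x, lyapunovWeight (mean N) β n x ∂law N ρ p n ≤ ENNReal.ofReal (2 * y) := by
  have hS0 : ∀ j, 0 ≤ ∑ i ∈ Finset.range j, ((i : ℝ) + 1) ^ (-β) := fun j =>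
    Finset.sum_nonneg fun i _ => by positivity
  have key : ∀ j, j ≤ n → ∫⁻ x, lyapunovWeight (mean N) β j x ∂law N ρ p j ≤
      ENNReal.ofReal (y * (1 + 4 * D * y * ∑ i ∈ Finset.range j, ((i : ℝ) + 1) ^ (-β))) := by
    intro j
    induction j with
    | zero => intro _; simpa [law] using hy
    | succ j ih =>
      intro hj
      have hle : 4 * D * y * ∑ i ∈ Finset.range j, ((i : ℝ) + 1) ^ (-β) ≤ 1 := by
        refine le_trans ?_ hn
        gcongr
        omega
      set S := ∑ i ∈ Finset.range j, ((i : ℝ) + 1) ^ (-β) with hS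
      have hSj : 0 ≤ S := hS0 j
      set z := y * (1 + 4 * D * y * S) with hz
      have hz0 : 0 ≤ z := by positivity
      have hz2 : z ≤ 2 * y := by rw [hz]; nlinarith
      refine (lintegral_lyapunovWeight_step_le hm hD hDu hβ0 hβ1 j (law_Iio_zero N hρ p j) hz0
        (hz2.trans hyu) (ih (by omega))).trans (ENNReal.ofReal_le_ofReal ?_)
      rw [Finset.sum_range_succ, ← hS]
      have hb : 0 ≤ ((j : ℝ) + 1) ^ (-β) := by positivity
      calc z * (1 + D * (((j : ℝ) + 1) ^ (-β) * z)) = z + D * ((j : ℝ) + 1) ^ (-β) * z ^ 2 := by ring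
        _ ≤ z + D * ((j : ℝ) + 1) ^ (-β) * (2 * y) ^ 2 := by gcongr
        _ = _ := by rw [hz]; ring
  refine (key n le_rfl).trans (ENNReal.ofReal_le_ofReal ?_)
  nlinarith

/-! ### The upper bound for the free energy -/

/-- The law of `Y_0` with the values above `a` replaced by `0`. -/
noncomputable def truncation (ρ : Measure ℝ) (a : ℝ) : Measure ℝ :=
  ρ.map (indicator (Iic a) id)

lemma measurable_indicator_Iic_id (a : ℝ) : Measurable (indicator (Iic a) (id : ℝ → ℝ)) :=
  measurable_id.indicator measurableSet_Iic

instance (ρ : Measure ℝ) [IsProbabilityMeasure ρ] (a : ℝ) :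
    IsProbabilityMeasure (truncation ρ a) :=
  Measure.isProbabilityMeasure_map (measurable_indicator_Iic_id a).aemeasurable

lemma truncation_Iio_zero {ρ : Measure ℝ} (hρ : ρ (Iio 0) = 0) (a : ℝ) :
    truncation ρ a (Iio 0) = 0 := by
  rw [truncation, Measure.map_apply (measurable_indicator_Iic_id a) measurableSet_Iio]
  refine measure_mono_null (fun x hx => ?_) hρ
  simp only [mem_preimage, mem_Iio, indicator] at hx ⊢
  split_ifs at hx
  · exact hx
  · exact absurd hx (lt_irrefl _)

/-- The cost of truncating at `2n` is at most of order `m^{-n}`, so that it is still negligible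
after the multiplication by `m^n` in the first `n` steps. -/
lemma dominated_truncation {ρ : Measure ℝ} {m : ℝ} (hm : 1 < m) (hρ : ρ (Iio 0) = 0) (n : ℕ) :
    Dominated (ENNReal.ofReal (1 / m ^ n) * ∫⁻ y, ENNReal.ofReal (y * m ^ (y / 2)) ∂ρ) ρ
      (truncation ρ (2 * n)) := by
  intro φ hφ
  have hm0 : 0 < m := by linarith
  have hφm := hφ.measurable
  have hi := measurable_indicator_Iic_id (2 * n)
  rw [truncation, lintegral_map hφm hi, ← lintegral_const_mul _ (by fun_prop),
    
    ← lintegral_add_left (f := fun y => φ (indicator (Iic (2 * (n : ℝ))) id y)) (hφm.comp hi)]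
  refine lintegral_mono_ae ?_
  filter_upwards [ae_nonneg hρ] with y hy
  rcases le_or_gt y (2 * n) with h | h
  · rw [indicator_of_mem (mem_Iic.2 h)]
    exact le_self_add
  · rw [indicator_of_notMem (by simpa using h)]
    refine (hφ.lip 0 y hy).trans (add_le_add le_rfl ?_)
    rw [← ENNReal.ofReal_mul (by positivity), sub_zero]
    refine ENNReal.ofReal_le_ofReal ?_
    have h1 : m ^ n ≤ m ^ (y / 2) := by
      rw [← Real.rpow_natCast]
      exact Real.rpow_le_rpow_of_exponent_le hm.le (by linarith)
    rw [one_div_mul_eq_div, le_div_iff₀ (by positivity)]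
    gcongr

/-- The initial value of the functional. -/
lemma exists_lintegral_lyapunovWeight_le {ρ : Measure ℝ} [IsProbabilityMeasure ρ] {m α β C : ℝ}
    (hm : 1 < m) (hρ : ρ (Iio 0) = 0) (hC0 : 0 < C)
    (hC : ∀ k : ℕ, ρ.real (Ici (k : ℝ)) ≤ C * ((k : ℝ) + 1) ^ α / m ^ k)
    (hβ0 : 0 ≤ β) (hβ1 : β ≤ 1) (hαβ : -1 < α + β) :
    ∃ C' : ℝ, 0 < C' ∧ ∀ n : ℕ, 1 ≤ n → ∀ p : ℝ, 0 ≤ p →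
      ∫⁻ x, lyapunovWeight m β 0 x ∂initialLaw (truncation ρ (2 * n)) p ≤
        ENNReal.ofReal (C' * p * (n : ℝ) ^ (α + β + 1)) := by
  have hm0 : 0 < m := by linarith
  obtain ⟨S, hS0, hS⟩ := sum_rpow_le hαβ
  refine ⟨2 * m * C * (S * 3 ^ (α + β + 1)), by positivity, fun n hn p hp => ?_⟩
  have hn1 : (1 : ℝ) ≤ n := by exact_mod_cast hn
  rw [lintegral_initialLaw, show lyapunovWeight m β 0 0 = 0 by simp [lyapunovWeight], mul_zero,
    zero_add, truncation,
    lintegral_map (measurable_lyapunovWeight m β 0) (measurable_indicator_Iic_id _)]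
  set b : ℕ → ℝ := fun k => if k < 2 * n + 1 then m ^ (k + 1) * (2 * ((k : ℝ) + 1) ^ β) else 0
    with hb
  have h1 : ∫⁻ y, lyapunovWeight m β 0 (indicator (Iic (2 * (n : ℝ))) id y) ∂ρ ≤
      ∑' k : ℕ, ENNReal.ofReal (b k) * ρ (Ici (k : ℝ)) := by
    refine lintegral_le_tsum hρ fun k y hk hy => ?_
    rcases le_or_gt y (2 * n) with h | h
    · rw [indicator_of_mem (mem_Iic.2 h), id]
      have hkn : k < 2 * n + 1 := by
        have : (k : ℝ) ≤ (2 * n : ℕ) := by push_cast; linarith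
        have := Nat.cast_le.1 this
        omega
      rcases (show 0 ≤ y from (Nat.cast_nonneg k).trans hk).eq_or_lt with rfl | hy0
      · simp [lyapunovWeight]
      · simp only [lyapunovWeight, indicator, mem_Ioi, hy0, if_true, hb, hkn]
        refine ENNReal.ofReal_le_ofReal ?_
        have e1 : m ^ y ≤ m ^ (k + 1) := by
          rw [← Real.rpow_natCast]
          exact Real.rpow_le_rpow_of_exponent_le hm.le (by push_cast; linarith)
        have e2 : (y + (0 : ℕ) + 1) ^ β ≤ 2 * ((k : ℝ) + 1) ^ β := by
          calc (y + (0 : ℕ) + 1) ^ β ≤ (2 * ((k : ℝ) + 1)) ^ β := by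
                gcongr
                push_cast
                linarith [Nat.cast_nonneg (α := ℝ) k]
            _ = 2 ^ β * ((k : ℝ) + 1) ^ β := Real.mul_rpow (by norm_num) (by positivity)
            _ ≤ 2 ^ (1 : ℝ) * ((k : ℝ) + 1) ^ β := by
                gcongr
                norm_num
            _ = _ := by rw [Real.rpow_one]
        gcongr
    · rw [indicator_of_notMem (by simpa using h)]
      simp [lyapunovWeight]
  have h2 : ∑' k : ℕ, ENNReal.ofReal (b k) * ρ (Ici (k : ℝ)) ≤
      ENNReal.ofReal (2 * m * C * ∑ k ∈ Finset.range (2 * n + 1), ((k : ℝ) + 1) ^ (α + β)) := by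
    rw [tsum_eq_sum (s := Finset.range (2 * n + 1)) (fun k hk => by
      rw [Finset.mem_range] at hk
      simp only [hb, if_neg hk, ENNReal.ofReal_zero, zero_mul]), Finset.mul_sum, ENNReal.ofReal_sum_of_nonneg fun k _ => by positivity]
    refine Finset.sum_le_sum fun k hk => ?_
    rw [Finset.mem_range] at hk
    simp only [hb, hk, if_true]
    rw [← ofReal_measureReal, ← ENNReal.ofReal_mul (by positivity)]
    refine ENNReal.ofReal_le_ofReal ?_
    calc m ^ (k + 1) * (2 * ((k : ℝ) + 1) ^ β) * ρ.real (Ici (k : ℝ))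
        ≤ m ^ (k + 1) * (2 * ((k : ℝ) + 1) ^ β) * (C * ((k : ℝ) + 1) ^ α / m ^ k) := by
          gcongr
          exact hC k
      _ = 2 * m * C * ((k : ℝ) + 1) ^ (α + β) := by
          rw [Real.rpow_add (by positivity), pow_succ]; field_simp
  have h3 : ∑ k ∈ Finset.range (2 * n + 1), ((k : ℝ) + 1) ^ (α + β)
      ≤ S * 3 ^ (α + β + 1) * (n : ℝ) ^ (α + β + 1) := by
    refine (hS _).trans ?_
    rw [mul_assoc, ← Real.mul_rpow (by norm_num) (by positivity)]
    gcongr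
    · linarith
    · push_cast; linarith
  calc ENNReal.ofReal p * ∫⁻ y, lyapunovWeight m β 0 (indicator (Iic (2 * (n : ℝ))) id y) ∂ρ
      ≤ ENNReal.ofReal p * ENNReal.ofReal
        (2 * m * C * (S * 3 ^ (α + β + 1) * (n : ℝ) ^ (α + β + 1))) := by
        gcongr
        refine (h1.trans h2).trans (ENNReal.ofReal_le_ofReal ?_)
        gcongr
    _ = _ := by
        rw [← ENNReal.ofReal_mul hp]
        congr 1
        ring

/-- If `p n^(α+2)` is small, then `E(X_n)` is bounded. -/
theorem exists_freeEnergy_le {N : Measure ℕ} [IsProbabilityMeasure N] (hm : 1 < mean N)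
    (hexp : ∃ t : ℝ, 1 < t ∧ Integrable (fun k : ℕ => t ^ k) N)
    {ρ : Measure ℝ} [IsProbabilityMeasure ρ] (hρ : ρ (Iio 0) = 0) {α C : ℝ} (hα : -2 < α)
    (hC0 : 0 < C)
    (hC : ∀ k : ℕ, ρ.real (Ici (k : ℝ)) ≤ C * ((k : ℝ) + 1) ^ α / mean N ^ k) :
    ∃ c₀ C₀ : ℝ, 0 < c₀ ∧ 0 < C₀ ∧ ∀ (p : Icc (0 : ℝ) 1) (n : ℕ), 1 ≤ n →
      p * (n : ℝ) ^ (α + 2) ≤ c₀ → freeEnergy N ρ p ≤ C₀ / mean N ^ n := by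
  obtain ⟨β, hβ, hβ1⟩ := exists_between (show max 0 (-1 - α) < 1 from
    max_lt one_pos (by linarith))
  have hβ0 : 0 < β := (le_max_left _ _).trans_lt hβ
  have hαβ : -1 < α + β := by linarith [(le_max_right _ _).trans_lt hβ]
  obtain ⟨D, u₀, hD, hu₀, hDu⟩ := exists_lintegral_mul_pow_le hm hexp
  obtain ⟨C₁, hC₁, hinit⟩ := exists_lintegral_lyapunovWeight_le hm hρ hC0 hC hβ0.le hβ1.le hαβ
  obtain ⟨S, hS0, hS⟩ := sum_rpow_le (show -1 < -β by linarith)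
  have hK := lintegral_mul_rpow_lt_top hm hρ hC
  have hρ1 := lintegral_ofReal_lt_top hm hρ hK
  set m := mean N with hmdef
  set K := ∫⁻ y, ENNReal.ofReal (y * m ^ (y / 2)) ∂ρ with hKdef
  have hm0 : 0 < m := by linarith
  have hlog : 0 < Real.log m := Real.log_pos hm
  refine ⟨min (u₀ / (2 * C₁)) (1 / (4 * D * C₁ * S)), u₀ / Real.log m + K.toReal,
    by positivity, by positivity, fun p n hn hpn => ?_⟩
  have hn1 : (1 : ℝ) ≤ n := by exact_mod_cast hn
  have hn0 : (0 : ℝ) < n := by linarith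
  have hp0 : (0 : ℝ) ≤ p := p.2.1
  set y := C₁ * p * (n : ℝ) ^ (α + β + 1) with hy
  have hy0 : 0 ≤ y := by positivity
  have e1 : y * (n : ℝ) ^ (1 - β) = C₁ * (p * (n : ℝ) ^ (α + 2)) := by
    rw [hy, mul_assoc, ← Real.rpow_add hn0, mul_assoc]
    ring_nf
  have hyu : 2 * y ≤ u₀ := by
    have h1 : y ≤ y * (n : ℝ) ^ (1 - β) :=
      le_mul_of_one_le_right hy0 (Real.one_le_rpow hn1 (by linarith))
    have h2 := hpn.trans (min_le_left _ _)
    rw [le_div_iff₀ (by positivity)] at h2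
    linarith
  have hsum : 4 * D * y * ∑ i ∈ Finset.range n, ((i : ℝ) + 1) ^ (-β) ≤ 1 := by
    have h2 := hpn.trans (min_le_right _ _)
    rw [le_div_iff₀ (by positivity)] at h2
    calc 4 * D * y * ∑ i ∈ Finset.range n, ((i : ℝ) + 1) ^ (-β)
        ≤ 4 * D * y * (S * (n : ℝ) ^ (-β + 1)) := by gcongr; exact hS n
      _ = 4 * D * S * (y * (n : ℝ) ^ (1 - β)) := by
          rw [show -β + 1 = 1 - β by ring]; ring
      _ ≤ 1 := by rw [e1]; linarith
  have hΦ := lintegral_lyapunovWeight_law_le hm hD hDu hβ0.le hβ1.le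
    (truncation_Iio_zero hρ (2 * n)) p hy0 hyu (hinit n hn p hp0) hsum
  have hE : ∫⁻ x, ENNReal.ofReal x ∂law N (truncation ρ (2 * n)) p n ≤
      ENNReal.ofReal (u₀ / Real.log m) := by
    calc ∫⁻ x, ENNReal.ofReal x ∂law N (truncation ρ (2 * n)) p n
        ≤ ∫⁻ x, ENNReal.ofReal (1 / Real.log m) * lyapunovWeight m β n x
            ∂law N (truncation ρ (2 * n)) p n := by
          refine lintegral_mono fun x => ?_
          rcases le_or_gt x 0 with h | h
          · simp [ENNReal.ofReal_of_nonpos h]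
          · simp only [lyapunovWeight, indicator, mem_Ioi, h, if_true]
            rw [← ENNReal.ofReal_mul (by positivity)]
            refine ENNReal.ofReal_le_ofReal ?_
            rw [one_div_mul_eq_div, le_div_iff₀ hlog]
            have h1 : x * Real.log m ≤ m ^ x := by
              rw [Real.rpow_def_of_pos hm0, mul_comm]
              linarith [Real.add_one_le_exp (Real.log m * x)]
            refine h1.trans (le_mul_of_one_le_right (by positivity)
              (Real.one_le_rpow ?_ hβ0.le))
            linarith
      _ = ENNReal.ofReal (1 / Real.log m) *
            ∫⁻ x, lyapunovWeight m β n x ∂law N (truncation ρ (2 * n)) p n :=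
          lintegral_const_mul _ (measurable_lyapunovWeight m β n)
      _ ≤ ENNReal.ofReal (1 / Real.log m) * ENNReal.ofReal u₀ := by
          gcongr
          exact hΦ.trans (ENNReal.ofReal_le_ofReal hyu)
      _ = _ := by
          rw [← ENNReal.ofReal_mul (by positivity), one_div_mul_eq_div]
  have hmain : ∫⁻ x, ENNReal.ofReal x ∂law N ρ p n ≤
      ENNReal.ofReal (u₀ / Real.log m + K.toReal) := by
    refine ((dominated_truncation hm hρ n).law hm p n _ IsTest.ofReal).trans ?_
    rw [ENNReal.ofReal_add (by positivity) (by positivity), ENNReal.ofReal_toReal hK.ne]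
    refine add_le_add hE (le_of_eq ?_)
    rw [← mul_assoc, ← ENNReal.ofReal_pow hm0.le, ← ENNReal.ofReal_mul (by positivity),
      mul_one_div_cancel (by positivity), ENNReal.ofReal_one, one_mul]
  refine (freeEnergy_le_normalizedMean hm hρ hρ1 p n).trans ?_
  rw [← ofReal_integral_law hm hρ hρ1, ENNReal.ofReal_le_ofReal_iff (by positivity)] at hmain
  rw [normalizedMean]
  gcongr

/-! ### The exponent of the free energy -/

/-- For fixed `p > 0`, the condition on `l` holds for all large `l` if `ε < α + 2`. -/
lemma freeEnergy_pos_of_eventually {F : ℝ → ℝ} {m α : ℝ} (hm : 1 < m) (hα : -2 < α)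
    (h : ∀ ε : ℝ, 0 < ε → ∃ B : ℕ, ∀ᶠ l : ℕ in atTop, ∀ p : Icc (0 : ℝ) 1,
      (l : ℝ) ^ ε ≤ p * (l : ℝ) ^ (α + 2) → 1 / m ^ (B * l) ≤ F p)
    (p : Icc (0 : ℝ) 1) (hp : (0 : ℝ) < p) : 0 < F p := by
  have hm0 : 0 < m := by linarith
  have hε : 0 < (α + 2) / 2 := by linarith
  obtain ⟨B, hB⟩ := h _ hε
  have h1 : ∀ᶠ l : ℕ in atTop, (p : ℝ)⁻¹ ≤ (l : ℝ) ^ ((α + 2) / 2) :=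
    ((tendsto_rpow_atTop hε).comp (tendsto_natCast_atTop_atTop (R := ℝ))).eventually_ge_atTop _
  obtain ⟨l, hl, hl1, hl0⟩ := (hB.and (h1.and (eventually_gt_atTop 0))).exists
  have hl0' : (0 : ℝ) < l := by exact_mod_cast hl0
  refine lt_of_lt_of_le (by positivity) (hl p ?_)
  have e : (l : ℝ) ^ (α + 2) = (l : ℝ) ^ ((α + 2) / 2) * (l : ℝ) ^ ((α + 2) / 2) := by
    rw [← Real.rpow_add hl0']; ring_nf
  rw [e, ← mul_assoc]
  refine le_mul_of_one_le_left (by positivity) ?_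
  calc (1 : ℝ) = p * (p : ℝ)⁻¹ := by field_simp
    _ ≤ _ := by gcongr

/-- With `l` of order `p^(-s)`, where `s` is slightly larger than `1 / (α + 2)`. -/
lemma eventually_exp_neg_le {F : ℝ → ℝ} {m α : ℝ} (hm : 1 < m) (hα : -2 < α)
    (h : ∀ ε : ℝ, 0 < ε → ∃ B : ℕ, ∀ᶠ l : ℕ in atTop, ∀ p : Icc (0 : ℝ) 1,
      (l : ℝ) ^ ε ≤ p * (l : ℝ) ^ (α + 2) → 1 / m ^ (B * l) ≤ F p)
    {η : ℝ} (hη : 0 < η) :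
    ∀ᶠ p in 𝓝[>] (0 : ℝ), Real.exp (-p ^ (-(1 / (α + 2) + η))) ≤ F p := by
  have hm0 : 0 < m := by linarith
  have hα2 : 0 < α + 2 := by linarith
  set s := 1 / (α + 2) + η / 2 with hs
  have hs0 : 0 < s := by positivity
  have hε : 0 < α + 2 - 1 / s := by
    rw [sub_pos, div_lt_iff₀ hs0, hs]
    have : (α + 2) * (1 / (α + 2) + η / 2) = 1 + (α + 2) * (η / 2) := by field_simp
    rw [this]
    linarith [mul_pos hα2 (half_pos hη)]
  obtain ⟨B, hB⟩ := h _ hε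
  have hlim := tendsto_rpow_neg_nhdsGT_zero (neg_lt_zero.2 hs0)
  have hceil : Tendsto (fun p : ℝ => ⌈p ^ (-s)⌉₊) (𝓝[>] 0) atTop := tendsto_nat_ceil_atTop.comp hlim
  filter_upwards [hceil.eventually hB, hlim.eventually_ge_atTop 1,
    (tendsto_rpow_neg_nhdsGT_zero (neg_lt_zero.2 (half_pos hη))).eventually_ge_atTop (2 * B * Real.log m),
    Ioo_mem_nhdsGT (one_pos (α := ℝ))] with p hp hp1 hp2 hp01
  have hp0 : 0 < p := hp01.1
  set l := ⌈p ^ (-s)⌉₊ with hl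
  have hl1 : p ^ (-s) ≤ l := Nat.le_ceil _
  have hl0 : (0 : ℝ) < l := by linarith
  have hl2 : (l : ℝ) ≤ 2 * p ^ (-s) := by
    linarith [Nat.ceil_lt_add_one (show 0 ≤ p ^ (-s) by positivity)]
  have hpl : (l : ℝ) ^ (-(1 / s)) ≤ p := by
    calc (l : ℝ) ^ (-(1 / s)) ≤ (p ^ (-s)) ^ (-(1 / s)) :=
          Real.rpow_le_rpow_of_nonpos (by positivity) hl1 (by simp [hs0.le])
      _ = p := by
          rw [← Real.rpow_mul hp0.le, neg_mul_neg, mul_one_div_cancel hs0.ne', Real.rpow_one]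
  refine le_trans ?_ (hp ⟨p, hp0.le, hp01.2.le⟩ ?_)
  · have e : 1 / m ^ (B * l) = Real.exp (-(B * l * Real.log m)) := by
      rw [Real.exp_neg, one_div, mul_comm _ (Real.log m), Real.exp_mul, Real.exp_log hm0,
        ← Nat.cast_mul, Real.rpow_natCast]
    rw [e, Real.exp_le_exp, neg_le_neg_iff]
    have hlog : 0 < Real.log m := Real.log_pos hm
    calc B * l * Real.log m ≤ B * (2 * p ^ (-s)) * Real.log m := by gcongr
      _ = (2 * B * Real.log m) * p ^ (-s) := by ring
      _ ≤ p ^ (-(η / 2)) * p ^ (-s) := by gcongr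
      _ = _ := by
          rw [← Real.rpow_add hp0, hs]
          ring_nf
  · calc (l : ℝ) ^ (α + 2 - 1 / s) = (l : ℝ) ^ (-(1 / s)) * (l : ℝ) ^ (α + 2) := by
          rw [← Real.rpow_add hl0]; ring_nf
      _ ≤ p * (l : ℝ) ^ (α + 2) := by gcongr

/-- With `n` the integer part of `(c₀ / p) ^ (1 / (α + 2))`. -/
lemma exists_eventually_le_exp_neg {F : ℝ → ℝ} {m α c₀ C₀ : ℝ} (hm : 1 < m) (hα : -2 < α)
    (hc₀ : 0 < c₀) (hC₀ : 0 < C₀)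
    (h : ∀ (p : Icc (0 : ℝ) 1) (n : ℕ), 1 ≤ n → p * (n : ℝ) ^ (α + 2) ≤ c₀ → F p ≤ C₀ / m ^ n) :
    ∃ c₅ : ℝ, 0 < c₅ ∧ ∀ᶠ p in 𝓝[>] (0 : ℝ), F p ≤ Real.exp (-(c₅ / p ^ (1 / (α + 2)))) := by
  have hm0 : 0 < m := by linarith
  have hlog : 0 < Real.log m := Real.log_pos hm
  have hα2 : 0 < α + 2 := by linarith
  set χ := 1 / (α + 2) with hχ
  have hχ0 : 0 < χ := by positivity
  set c₅ := c₀ ^ χ * Real.log m / 2 with hc₅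
  have hc₅0 : 0 < c₅ := by positivity
  have hlim := tendsto_rpow_neg_nhdsGT_zero (neg_lt_zero.2 hχ0)
  refine ⟨c₅, hc₅0, ?_⟩
  filter_upwards [(hlim.const_mul_atTop (show 0 < c₀ ^ χ by positivity)).eventually_ge_atTop 1,
    (hlim.const_mul_atTop hc₅0).eventually_ge_atTop (Real.log (C₀ * m)),
    Ioo_mem_nhdsGT (one_pos (α := ℝ))] with p hp1 hp2 hp01
  have hp0 : 0 < p := hp01.1
  set x := c₀ ^ χ * p ^ (-χ) with hx
  have hx0 : 0 ≤ x := by positivity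
  have hn : 1 ≤ ⌊x⌋₊ := Nat.le_floor (by exact_mod_cast hp1)
  have hpow : x ^ (α + 2) = c₀ / p := by
    have e : χ * (α + 2) = 1 := by rw [hχ]; field_simp
    rw [hx, Real.mul_rpow (by positivity) (by positivity), ← Real.rpow_mul hc₀.le,
      ← Real.rpow_mul hp0.le, neg_mul, e, Real.rpow_one, Real.rpow_neg_one]
    rfl
  have h1 := h ⟨p, hp0.le, hp01.2.le⟩ ⌊x⌋₊ hn (by
    calc p * (⌊x⌋₊ : ℝ) ^ (α + 2) ≤ p * x ^ (α + 2) := by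
          gcongr
          exact Nat.floor_le hx0
      _ = c₀ := by rw [hpow]; field_simp)
  refine h1.trans ?_
  have e1 : C₀ / m ^ ⌊x⌋₊ = Real.exp (Real.log (C₀ * m) - (⌊x⌋₊ + 1) * Real.log m) := by
    rw [Real.exp_sub, Real.exp_log (by positivity), mul_comm _ (Real.log m), Real.exp_mul,
      Real.exp_log hm0, ← Nat.cast_add_one, Real.rpow_natCast, pow_succ]
    field_simp
  have h2 : x * Real.log m ≤ (⌊x⌋₊ + 1) * Real.log m := by
    gcongr
    exact (Nat.lt_floor_add_one x).le
  have e2 : x * Real.log m = 2 * (c₅ * p ^ (-χ)) := by rw [hx, hc₅]; ring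
  have e3 : c₅ / p ^ χ = c₅ * p ^ (-χ) := by rw [Real.rpow_neg hp0.le]; rfl
  rw [e1, Real.exp_le_exp, e3]
  linarith

/-- The bounds `exp (-p^(-(χ+η))) ≤ F p ≤ exp (-c₅ p^(-χ))`, for every `η > 0`, amount to
`F p = exp (-1 / p^(χ+o(1)))`. -/
lemma exists_exponent {F : ℝ → ℝ} {χ c₅ : ℝ} (hc₅ : 0 < c₅)
    (hpos : ∀ᶠ p in 𝓝[>] (0 : ℝ), 0 < F p)
    (hle : ∀ᶠ p in 𝓝[>] (0 : ℝ), F p ≤ Real.exp (-(c₅ / p ^ χ)))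
    (hge : ∀ η : ℝ, 0 < η → ∀ᶠ p in 𝓝[>] (0 : ℝ), Real.exp (-p ^ (-(χ + η))) ≤ F p) :
    ∃ o : ℝ → ℝ, Tendsto o (𝓝[>] 0) (𝓝 0) ∧ ∀ᶠ p in 𝓝[>] (0 : ℝ),
      F p = Real.exp (-(1 / p ^ (χ + o p))) := by
  -- `o` is the solution of `p ^ (χ + o p) = 1 / (-log (F p))`
  refine ⟨fun p => Real.log (-Real.log (F p)) / (-Real.log p) - χ, ?_, ?_⟩
  · rw [Metric.tendsto_nhds]
    intro η hη
    have hlogp : Tendsto (fun p : ℝ => -Real.log p) (𝓝[>] 0) atTop :=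
      tendsto_neg_atBot_atTop.comp Real.tendsto_log_nhdsGT_zero
    have hη2 := half_pos hη
    filter_upwards [hpos, hle, hge (η / 2) hη2, hlogp.eventually_gt_atTop 0,
      (hlogp.const_mul_atTop hη2).eventually_ge_atTop (-Real.log c₅),
      self_mem_nhdsWithin] with p h0 h1 h2 h3 h4 h5
    have hp0 : 0 < p := h5
    have hL1 : c₅ * p ^ (-χ) ≤ -Real.log (F p) := by
      have := (Real.log_le_iff_le_exp h0).2 h1
      rw [Real.rpow_neg hp0.le, ← div_eq_mul_inv]
      linarith
    have hL2 : -Real.log (F p) ≤ p ^ (-(χ + η / 2)) := by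
      have := (Real.le_log_iff_exp_le h0).2 h2
      linarith
    have hLpos : 0 < -Real.log (F p) := lt_of_lt_of_le (by positivity) hL1
    have hlow : Real.log c₅ + χ * -Real.log p ≤ Real.log (-Real.log (F p)) := by
      refine le_trans (le_of_eq ?_) (Real.log_le_log (by positivity) hL1)
      rw [Real.log_mul hc₅.ne' (by positivity), Real.log_rpow hp0]
      ring
    have hupp : Real.log (-Real.log (F p)) ≤ (χ + η / 2) * -Real.log p := by
      refine (Real.log_le_log hLpos hL2).trans (le_of_eq ?_)
      rw [Real.log_rpow hp0]
      ring
    rw [Real.dist_eq, sub_zero, abs_lt]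
    constructor
    · rw [lt_sub_iff_add_lt, lt_div_iff₀ h3]
      nlinarith
    · rw [sub_lt_iff_lt_add, div_lt_iff₀ h3]
      nlinarith
  · filter_upwards [hpos, hle, Ioo_mem_nhdsGT (one_pos (α := ℝ))] with p h0 h1 hp01
    have hp0 : 0 < p := hp01.1
    have hlogp : Real.log p < 0 := Real.log_neg hp0 hp01.2
    have hLpos : 0 < -Real.log (F p) := by
      have := (Real.log_le_iff_le_exp h0).2 h1
      have : 0 < c₅ / p ^ χ := by positivity
      linarith
    have e : p ^ (χ + (Real.log (-Real.log (F p)) / (-Real.log p) - χ)) = (-Real.log (F p))⁻¹ := by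
      rw [Real.rpow_def_of_pos hp0, ← Real.exp_log hLpos, ← Real.exp_neg, Real.exp_log hLpos]
      congr 1
      have := hlogp.ne
      field_simp
      ring
    rw [e, one_div, inv_inv, neg_neg, Real.exp_log h0]

end DerridaRetaux

theorem theorem1p5
    -- the law of `ν`, with values in `{1, 2, …}`
    (N : Measure ℕ) [IsProbabilityMeasure N] (hN : N {0} = 0)
    (hexp : ∃ t : ℝ, 1 < t ∧ Integrable (fun k : ℕ => t ^ k) N)
    (hm : 1 < DerridaRetaux.mean N)
    -- the law of `Y_0`, with values in `(0, ∞)`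
    (ρ : Measure ℝ) [IsProbabilityMeasure ρ] (hρ : ρ (Iic 0) = 0)
    (α : ℝ) (hα : -2 < α)
    (htail : ∃ c₃ c₄ : ℝ, 0 < c₃ ∧ c₃ ≤ c₄ ∧ ∀ᶠ x : ℝ in atTop,
      c₃ * x ^ α * DerridaRetaux.mean N ^ (-x) ≤ ρ.real (Ici x) ∧
      ρ.real (Ici x) ≤ c₄ * x ^ α * DerridaRetaux.mean N ^ (-x)) :
    -- the free energy is well defined, as a decreasing limit
    (∀ p ∈ Icc (0 : ℝ) 1,
      (∀ n, Integrable (fun x : ℝ => x) (DerridaRetaux.law N ρ p n)) ∧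
      Antitone (DerridaRetaux.normalizedMean N ρ p) ∧
      Tendsto (DerridaRetaux.normalizedMean N ρ p) atTop
        (𝓝 (DerridaRetaux.freeEnergy N ρ p))) ∧
    -- `p_c = 0`
    DerridaRetaux.IsCriticalParameter N ρ 0 ∧
    -- `F_∞(p) = exp (-1 / p ^ (χ + o(1)))` as `p ↓ 0`, with `χ = 1 / (α + 2)`
    (∃ o : ℝ → ℝ, Tendsto o (𝓝[>] 0) (𝓝 0) ∧ ∀ᶠ p in 𝓝[>] (0 : ℝ),
      DerridaRetaux.freeEnergy N ρ p = Real.exp (-(1 / p ^ (1 / (α + 2) + o p)))) ∧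
    -- the sharper upper bound
    (∃ c₅ : ℝ, 0 < c₅ ∧ ∀ᶠ p in 𝓝[>] (0 : ℝ),
      DerridaRetaux.freeEnergy N ρ p ≤ Real.exp (-(c₅ / p ^ (1 / (α + 2))))) := by
  obtain ⟨c₃, c₄, hc₃, -, htail⟩ := htail
  have hρ0 : ρ (Iio 0) = 0 := measure_mono_null Iio_subset_Iic_self hρ
  have h2 := DerridaRetaux.integrable_sq hexp
  obtain ⟨C, hC0, hC⟩ := DerridaRetaux.exists_real_Ici_le hm htail
  have hρ1 := DerridaRetaux.lintegral_ofReal_lt_top hm hρ0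
    (DerridaRetaux.lintegral_mul_rpow_lt_top hm hρ0 hC)
  have hlower := fun (ε : ℝ) (hε : 0 < ε) =>
    DerridaRetaux.exists_le_freeEnergy hm h2 hρ0 hρ1 hc₃ htail hε
  obtain ⟨c₀, C₀, hc₀, hC₀, hupper⟩ := DerridaRetaux.exists_freeEnergy_le hm hexp hρ0 hα hC0 hC
  have hpos := DerridaRetaux.freeEnergy_pos_of_eventually hm hα hlower
  obtain ⟨c₅, hc₅, hle⟩ :=
    DerridaRetaux.exists_eventually_le_exp_neg hm hα hc₀ hC₀ hupper
  refine ⟨fun p hp => ⟨DerridaRetaux.integrable_law hm hρ0 hρ1 ⟨p, hp⟩,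
    DerridaRetaux.antitone_normalizedMean hm hρ0 hρ1 ⟨p, hp⟩,
    DerridaRetaux.tendsto_normalizedMean hm hρ0 hρ1 ⟨p, hp⟩⟩,
    ⟨⟨le_rfl, zero_le_one⟩, fun p hp => ⟨fun h => hpos ⟨p, hp⟩ h,
      fun h => absurd hp.1 (not_le.2 h)⟩⟩, ?_, c₅, hc₅, hle⟩
  refine DerridaRetaux.exists_exponent hc₅ ?_ hle
    fun η hη => DerridaRetaux.eventually_exp_neg_le hm hα hlower hη
  filter_upwards [Ioo_mem_nhdsGT (one_pos (α := ℝ))] with p hp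
  exact hpos ⟨p, hp.1.le, hp.2.le⟩ hp.1
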